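/- **Setting.** Let $\{(Y_{t+1},X_t)\}_{t\in\mathbb Z}$ be a strictly stationary sequence, $S_t=(Y_{t+1},X_t)$, with $\beta$-mixing coefficients $\beta(j)=\sup_t\mathbb E\,\operatorname{ess\,sup}\{|P(B\mid\mathcal F_{-\infty}^t)-P(B)|:B\in\mathcal F_{t+j}^\infty\}\le\beta_0e^{-cj}$ for some $\beta_0,c>0$, where $\mathcal F_s^t$ is generated by $S_s,\dots,S_t$. Parameters are pairs $\alpha=(\theta,h)$, $\theta\in\mathbb R^d$, $h:\mathbb R^q\to\mathbb R$, with strong norm $\|\alpha\|_{\infty,\omega}=\|\theta\|+\sup_s|h(s)|(1+|s|^2)^{-\omega/2}$, $\omega>0$; $\alpha_0=(\theta_0,h_0)$ is a fixed parameter. For a real residual function $\rho(y,\alpha)$ let $m(x,\alpha)=\mathbb E[\rho(Y_{t+1},\alpha)\mid X_t=x]$, computed for all $\alpha$ from one regular conditional distribution of $Y_{t+1}$ given $X_t$, and put $\Sigma(x)=\mathrm{Var}(\rho(Y_{t+1},\alpha_0)\mid X_t=x)$, $\epsilon(S_t,\alpha)=\rho(Y_{t+1},\alpha)-m(X_t,\alpha)$,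 $Q(\alpha)=\mathbb E\,m(X_t,\alpha)^2\Sigma(X_t)^{-1}$. The weak norm is $\|v\|^2=\mathbb E\big(\tfrac{dm(X_t,\alpha_0)}{d\alpha}[v]\big)^2\Sigma(X_t)^{-1}$, with $\tfrac{dm(x,\alpha_0)}{d\alpha}[v]=\partial_\theta m(x,\alpha_0)'v_\theta+\tfrac{d}{d\tau}m(x,\theta_0,h_0+\tau v_h)|_{\tau=0}$. Let $\mathcal A_n=\Theta\times\mathcal H_n$ with $\Theta\subset\mathbb R^d$ compact and $\mathcal H_n$ a set of functions on $\mathbb R^q$ whose covering numbers by closed $\|\cdot\|_{\infty,\omega}$-balls satisfy $\mathcal N(\delta,\mathcal H_n,\|\cdot\|_{\infty,\omega})\le(Cn/\delta)^{p(\mathcal H_n)}$ for $0<\delta\le1$, where $p(\mathcal H_n)\to\infty$ and $p(\mathcal H_n)\log n=o(n)$. Let $\Psi_1,\dots,\Psi_{k_n}$ be functions of $X_t$ (which may depend on $n$), $k_n=O(n)$. Let $\pi_n\alpha_0\in\mathcal A_n$ minimize $\|\alpha-\alpha_0\|_{\infty,\omega}$ over $\alpha\in\mathcal A_n$. For sequences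 $\lambda_n,\varphi_n\ge0$ let $$d_n=\sqrt{\tfrac{p(\mathcal H_n)\log^2n}{n}},\quad \bar\delta_n^2=\|\pi_n\alpha_0-\alpha_0\|^2+\lambda_n+k_nd_n^2+\varphi_n^2,\quad \delta_n=\|\pi_n\alpha_0-\alpha_0\|_{\infty,\omega}+\omega_n(\bar\delta_n),$$ with $\omega_n(\delta)=\sup\{\|\alpha-\pi_n\alpha_0\|_{\infty,\omega}:\alpha\in\mathcal A_n,\ \|\alpha-\pi_n\alpha_0\|\le\delta\}$. Let $u_n$ be directions (such as normalized Riesz representers), fix $C>0$, and let $$\mathcal C_n=\{\alpha+xu_n:\alpha\in\mathcal A_n,\ \|\alpha-\alpha_0\|_{\infty,\omega}\le C\delta_n,\ Q(\alpha)\le C\bar\delta_n^2,\ |x|\le Cn^{-1/2}\}.$$ Let $\overline{\mathcal A}_n=\mathrm{cl}\{a+xb:a,b\in\mathcal A_n,x\in\mathbb R\}$, the closure being in $\|\cdot\|_{\infty,\omega}$. Suppose that $\rho(\cdot,\alpha)$ is measurable and $\rho(Y_{t+1},\alpha)$ integrable for $\alpha\in\overline{\mathcal A}_n\cup\{\alpha_0\}$;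 that $\alpha+xu_n\in\overline{\mathcal A}_n$ for $\alpha\in\mathcal C_n$, $|x|\le Cn^{-1/2}$; and that, for some constants, $\|u_n\|_{\infty,\omega}=O(n^{q_2})$ and $n^{-q_1}=O(\delta_n)$. Expectations of suprema are outer expectations under the law of $S_t$, and probabilities of suprema are outer probabilities. **Proposition A.1 (stochastic equicontinuity).** Suppose that, with constants not depending on $n$: (a) for some $\eta>0$, $\ \mathbb E\max_{j\le k_n}\Psi_j(X_t)^2\sup_{\alpha\in\mathcal C_n,\,|x|\le Cn^{-1/2}}\big(\rho(Y_{t+1},\alpha+xu_n)-\rho(Y_{t+1},\alpha_0)\big)^2=O(\delta_n^{2\eta})$; (b) for some $\kappa,C'>0$, $\ \mathbb E\,\Psi_j(X_t)^2\sup_{\alpha_1\in\overline{\mathcal A}_n,\ \|\alpha_1-\alpha\|_{\infty,\omega}<\delta}|\epsilon(S_t,\alpha_1)-\epsilon(S_t,\alpha)|^2\le C'\delta^{2\kappa}$ for all $\delta>0$, $\alpha\in\overline{\mathcal A}_n$, $j\le k_n$ and $n\ge1$. Then $$\max_{j\le k_n}\ \sup_{|x|\le Cn^{-1/2}}\ \sup_{\alpha\in\mathcal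 C_n}\Big|\frac1n\sum_{t=1}^n\Psi_j(X_t)\big(\epsilon(S_t,\alpha+xu_n)-\epsilon(S_t,\alpha_0)\big)\Big|=O_P(d_n\delta_n^\eta).$$ -/

import Mathlib

open MeasureTheory ProbabilityTheory Filter
open scoped ENNReal NNReal

namespace SieveLearning

/-! ### Parameters and the strong norm -/

/-- A parameter `α = (θ, h)`: a Euclidean vector `θ` and a real function `h` on `ℝ^q`. -/
abbrev Param (d q : ℕ) : Type :=
  EuclideanSpace ℝ (Fin d) × (EuclideanSpace ℝ (Fin q) → ℝ)

/-- The weighted sup-norm `‖h‖_{∞,w} = sup_s |h(s)| (1 + |s|²)^{-w/2}`, with values in `[0, ∞]`. -/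
noncomputable def weightedSupNorm {q : ℕ} (w : ℝ) (h : EuclideanSpace ℝ (Fin q) → ℝ) : ℝ≥0∞ :=
  ⨆ s, ENNReal.ofReal (|h s| * (1 + ‖s‖ ^ 2) ^ (-w / 2))

/-- The strong norm `‖(θ, h)‖_{∞,w} = ‖θ‖ + ‖h‖_{∞,w}`, with values in `[0, ∞]`. -/
noncomputable def strongNorm {d q : ℕ} (w : ℝ) (α : Param d q) : ℝ≥0∞ :=
  ‖α.1‖ₑ + weightedSupNorm w α.2

/-- The minimal number of closed `‖·‖_{∞,w}`-balls of radius `δ` needed to cover `H`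
(`⊤` if no finite number suffices). The centres may be arbitrary functions. -/
noncomputable def coveringNumber {q : ℕ} (w δ : ℝ)
    (H : Set (EuclideanSpace ℝ (Fin q) → ℝ)) : ℕ∞ :=
  ⨅ (T : Finset (EuclideanSpace ℝ (Fin q) → ℝ))
    (_ : ∀ h ∈ H, ∃ g ∈ T, weightedSupNorm w (h - g) ≤ ENNReal.ofReal δ), (T.card : ℕ∞)

/-- `cl {a + x b : a, b ∈ A, x ∈ ℝ}`, the closure being taken for the strong norm. -/
def perturbationClosure {d q : ℕ} (w : ℝ) (A : Set (Param d q)) : Set (Param d q) :=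
  {α | ∀ e : ℝ≥0∞, 0 < e → ∃ a ∈ A, ∃ b ∈ A, ∃ x : ℝ, strongNorm w (α - (a + x • b)) < e}

/-! ### The conditional moment model

`κ` is a regular conditional distribution of `Y_{t+1}` given `X_t`, `ν` is the law of `X_t`, and
`ρ y α` is the generalized residual. -/

section Model

variable {𝒴 𝒳 : Type*} [MeasurableSpace 𝒴] [MeasurableSpace 𝒳] {d q : ℕ}

/-- `m(x, α) = E[ρ(Y_{t+1}, α) | X_t = x]`. -/
noncomputable def condMean (κ : Kernel 𝒳 𝒴) (ρ : 𝒴 → Param d q → ℝ) (x : 𝒳) (α : Param d q) : ℝ :=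
  ∫ y, ρ y α ∂(κ x)

/-- `Σ(x) = Var(ρ(Y_{t+1}, α₀) | X_t = x)`, with values in `[0, ∞]`. -/
noncomputable def condVar (κ : Kernel 𝒳 𝒴) (ρ : 𝒴 → Param d q → ℝ) (α₀ : Param d q) (x : 𝒳) :
    ℝ≥0∞ :=
  evariance (fun y => ρ y α₀) (κ x)

/-- `ε(s, α) = ρ(y, α) - m(x, α)` for `s = (y, x)`. -/
noncomputable def residual (κ : Kernel 𝒳 𝒴) (ρ : 𝒴 → Param d q → ℝ) (s : 𝒴 × 𝒳)
    (α : Param d q) : ℝ :=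
  ρ s.1 α - condMean κ ρ s.2 α

/-- The criterion `Q(α) = E[m(X_t, α)² Σ(X_t)⁻¹]`. -/
noncomputable def criterion (ν : Measure 𝒳) (κ : Kernel 𝒳 𝒴) (ρ : 𝒴 → Param d q → ℝ)
    (α₀ α : Param d q) : ℝ≥0∞ :=
  ∫⁻ x, ‖condMean κ ρ x α‖ₑ ^ 2 * (condVar κ ρ α₀ x)⁻¹ ∂ν

/-- The pathwise (Gateaux) derivative of `m(x, ·)` at `α₀ = (θ₀, h₀)` in the direction
`v = (v_θ, v_h)`:
`(∂m(x, α₀)/∂θ)' v_θ + (d/dτ) m(x, θ₀, h₀ + τ v_h)` at `τ = 0`. -/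
noncomputable def gateaux (κ : Kernel 𝒳 𝒴) (ρ : 𝒴 → Param d q → ℝ) (α₀ : Param d q) (x : 𝒳)
    (v : Param d q) : ℝ :=
  fderiv ℝ (fun θ => condMean κ ρ x (θ, α₀.2)) α₀.1 v.1
    + deriv (fun τ : ℝ => condMean κ ρ x (α₀.1, α₀.2 + τ • v.2)) 0

/-- The weak norm `‖v‖ = (E[(dm(X_t, α₀)/dα [v])² Σ(X_t)⁻¹])^{1/2}`. -/
noncomputable def weakNorm (ν : Measure 𝒳) (κ : Kernel 𝒳 𝒴) (ρ : 𝒴 → Param d q → ℝ)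
    (α₀ v : Param d q) : ℝ≥0∞ :=
  (∫⁻ x, ‖gateaux κ ρ α₀ x v‖ₑ ^ 2 * (condVar κ ρ α₀ x)⁻¹ ∂ν) ^ (1 / 2 : ℝ)

/-- The sieve modulus of continuity: the supremum of `‖α - π‖_{∞,w}` over `α ∈ A` with
weak norm `‖α - π‖ ≤ δ`; here `π` is the best approximation of `α₀` in `A`. -/
noncomputable def sieveModulus (w : ℝ) (ν : Measure 𝒳) (κ : Kernel 𝒳 𝒴) (ρ : 𝒴 → Param d q → ℝ)
    (α₀ : Param d q) (A : Set (Param d q)) (π : Param d q) (δ : ℝ≥0∞) : ℝ≥0∞ :=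
  ⨆ α ∈ A, ⨆ (_ : weakNorm ν κ ρ α₀ (α - π) ≤ δ), strongNorm w (α - π)

/-- `π` is a best approximation of `α₀` in `A` for the strong norm. -/
def IsBestApprox (w : ℝ) (A : Set (Param d q)) (α₀ π : Param d q) : Prop :=
  π ∈ A ∧ ∀ α ∈ A, strongNorm w (π - α₀) ≤ strongNorm w (α - α₀)

/-- `d_n = (p log² n / n)^{1/2}` for a learning space of dimension `p`. -/
noncomputable def complexityRate (p : ℝ) (n : ℕ) : ℝ :=
  √(p * Real.log n ^ 2 / n)

/-- `δ̄_n = (‖π - α₀‖² + lam + k d_n² + φ²)^{1/2}`. -/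
noncomputable def weakRate (ν : Measure 𝒳) (κ : Kernel 𝒳 𝒴) (ρ : 𝒴 → Param d q → ℝ)
    (α₀ π : Param d q) (lam φ : ℝ≥0) (k : ℕ) (p : ℝ) (n : ℕ) : ℝ≥0∞ :=
  (weakNorm ν κ ρ α₀ (π - α₀) ^ 2 + (lam : ℝ≥0∞)
    + (k : ℝ≥0∞) * ENNReal.ofReal (complexityRate p n) ^ 2 + (φ : ℝ≥0∞) ^ 2) ^ (1 / 2 : ℝ)

/-- `δ_n = ‖π - α₀‖_{∞,w} + ω_n(δ̄_n)`. -/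
noncomputable def strongRate (w : ℝ) (ν : Measure 𝒳) (κ : Kernel 𝒳 𝒴) (ρ : 𝒴 → Param d q → ℝ)
    (α₀ : Param d q) (A : Set (Param d q)) (π : Param d q) (lam φ : ℝ≥0) (k : ℕ) (p : ℝ)
    (n : ℕ) : ℝ≥0∞ :=
  strongNorm w (π - α₀) + sieveModulus w ν κ ρ α₀ A π (weakRate ν κ ρ α₀ π lam φ k p n)

/-- The local neighbourhood
`𝒞_n = {α + x u : α ∈ A, ‖α - α₀‖_{∞,w} ≤ C δ, Q(α) ≤ C δ̄², |x| ≤ C n^{-1/2}}`. -/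
def localNbhd (w C : ℝ) (ν : Measure 𝒳) (κ : Kernel 𝒳 𝒴) (ρ : 𝒴 → Param d q → ℝ)
    (α₀ : Param d q) (A : Set (Param d q)) (u : Param d q) (δ δbar : ℝ≥0∞) (n : ℕ) :
    Set (Param d q) :=
  {β | ∃ α ∈ A, strongNorm w (α - α₀) ≤ ENNReal.ofReal C * δ ∧
    criterion ν κ ρ α₀ α ≤ ENNReal.ofReal C * δbar ^ 2 ∧
    ∃ x : ℝ, |x| ≤ C / √n ∧ β = α + x • u}

end Model

/-! ### Probability -/

/-- The outer expectation `E* f`: the infimum of `E g` over measurable `g ≥ f`. It equals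
`∫⁻ f ∂P` when `f` is measurable. -/
noncomputable def outerExpectation {S : Type*} [MeasurableSpace S] (P : Measure S)
    (f : S → ℝ≥0∞) : ℝ≥0∞ :=
  ⨅ (g : S → ℝ≥0∞) (_ : Measurable g) (_ : ∀ s, f s ≤ g s), ∫⁻ s, g s ∂P

/-- Strict stationarity: the law of the whole process is invariant under time shifts. -/
def StrictlyStationary {Ω S : Type*} [MeasurableSpace Ω] [MeasurableSpace S] (μ : Measure Ω)
    (Z : ℤ → Ω → S) : Prop :=
  ∀ l : ℤ, μ.map (fun ω t => Z (t + l) ω) = μ.map (fun ω t => Z t ω)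

/-- The σ-field generated by `Z_s`, `s ≤ t`. -/
@[reducible] def pastSigma {Ω S : Type*} [MeasurableSpace S] (Z : ℤ → Ω → S) (t : ℤ) : MeasurableSpace Ω :=
  ⨆ s : {s : ℤ // s ≤ t}, MeasurableSpace.comap (Z s) inferInstance

/-- The σ-field generated by `Z_s`, `s ≥ t`. -/
@[reducible] def futureSigma {Ω S : Type*} [MeasurableSpace S] (Z : ℤ → Ω → S) (t : ℤ) : MeasurableSpace Ω :=
  ⨆ s : {s : ℤ // t ≤ s}, MeasurableSpace.comap (Z s) inferInstance

/-- The β-mixing coefficient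
`β(j) = sup_t E sup {|P(B | 𝓕_{-∞}^t) - P(B)| : B ∈ 𝓕_{t+j}^∞}`.
As conditional probabilities are only defined up to null sets, the inner supremum is the
essential supremum of the family; its expectation is the supremum, over finite families of
events `B`, of the expected maximum. -/
noncomputable def betaMixing {Ω S : Type*} [MeasurableSpace Ω] [MeasurableSpace S] (μ : Measure Ω)
    (Z : ℤ → Ω → S) (j : ℕ) : ℝ≥0∞ :=
  ⨆ (t : ℤ) (F : Finset (Set Ω)) (_ : ∀ B ∈ F, MeasurableSet[futureSigma Z (t + j)] B),
    ∫⁻ ω, ⨆ B ∈ F, ‖(μ⟦B | pastSigma Z t⟧) ω - μ.real B‖ₑ ∂μ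

/-- `Z_n = O_P(r_n)` for `[0, ∞]`-valued `Z_n`; `μ` of a non-measurable set is its outer
probability. -/
def IsBigOInProb {Ω : Type*} [MeasurableSpace Ω] (μ : Measure Ω) (Z : ℕ → Ω → ℝ≥0∞)
    (r : ℕ → ℝ≥0∞) : Prop :=
  ∀ e : ℝ, 0 < e → ∃ M : ℝ≥0, ∀ᶠ n in atTop,
    μ {ω | (M : ℝ≥0∞) * r n < Z n ω} ≤ ENNReal.ofReal e

end SieveLearning

open SieveLearning

/-!
The proof combines one finite net, a truncation at the envelope, and decoupling of the observations
along residue classes.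

Write `a = δ_n ^ η`, `d_n` for the complexity rate, and `W j α` for the summand `Ψ_j (ε(·, α) -
ε(·, α₀))`. By the moment condition `h_a` and conditional centring, all `(W j α)²` are bounded by
one function `G` with `E G = O(a²)` (`exists_centred_envelope`). The summands are truncated at the
level `a / d_n`: the part where `√G` exceeds it contributes at most `d_n / a` times the sample
mean of `G`, so `O_P(d_n a)` by Markov's inequality. What remains is bounded by `a / d_n` and has
variance `O(a²)`, the borderline case in which an exponential inequality gives tails `exp (-M n
d_n² / b)` for samples that can be split into `b` independent parts.

Such a splitting comes from mixing. The sample is divided into its residue classes modulo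
`b ≈ (2 / c) log n`. Within one class consecutive observations are `b` apart, so its law is within
`n / b` times `β(b)` of the independent law in total variation (`map_spaced_sample_le`, resting on
`map_prodMk_le_of_mixing`). This is a comparison of laws, so it is paid once for a whole family of
functions (`mixing_maximal_inequality`), and over all classes it amounts to `O(n β(b)) = O(1 / n)`.

The supremum over parameters is reduced to a net of mesh `n ^ (-κ₀)`, whose logarithmic cardinality is
`O(p log n)` (`exists_net_of_entropy`). Since `n d_n² = p log² n`, the exponent `n d_n² / b` is of order
`p log n`, and a large `M` beats the entropy (`mixing_error_le`). Oscillations around the net have, by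
`h_b`, a mean square that is polynomially small with exponent at will, hence negligible against `a` and
`d_n`, which are bounded below by powers of `n` (`oscillation_le`). They too are functions of one
observation, bounded by a constant times `a / d_n` after truncation, and are handled by the same
maximal inequality (`mixing_maximal_inequality_of_envelope`).
-/

namespace SieveLearning

/-! ### Decoupling under β-mixing -/

section Decoupling

variable {Ω 𝒰 𝒱 : Type*}

lemma stepSet_eq_iUnion {ι : Type} (g : 𝒰 → ι) (B : ι → Set 𝒱) :
    {z : 𝒰 × 𝒱 | z.2 ∈ B (g z.1)} = ⋃ i, (g ⁻¹' {i}) ×ˢ B i := by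
  ext z; simp

variable [MeasurableSpace 𝒰] [MeasurableSpace 𝒱]

/-- The sets `{(u, v) | v ∈ B (g u)}` with `g` measurable and finite-valued. These are the finite
unions of measurable rectangles, written so that the first factors form a partition. -/
def IsStepSet (E : Set (𝒰 × 𝒱)) : Prop :=
  ∃ (ι : Type) (_ : Fintype ι) (g : 𝒰 → ι) (B : ι → Set 𝒱),
    (∀ i, MeasurableSet (g ⁻¹' {i})) ∧ (∀ i, MeasurableSet (B i)) ∧ E = {z | z.2 ∈ B (g z.1)}

lemma isStepSet_prod {s : Set 𝒰} {t : Set 𝒱} (hs : MeasurableSet s) (ht : MeasurableSet t) :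
    IsStepSet (s ×ˢ t) := by
  classical
  refine ⟨Prop, inferInstance, fun u => u ∈ s, fun P => {v | P ∧ v ∈ t}, fun i => ?_, fun i => ?_,
    ?_⟩
  · by_cases h : i
    · simpa [Set.preimage, h] using hs
    · have : (fun u => u ∈ s) ⁻¹' {i} = sᶜ := by ext; simp [h]
      rw [this]; exact hs.compl
  · by_cases h : i <;> simp [h, ht]
  · ext z; simp

lemma isSetAlgebra_isStepSet : IsSetAlgebra {E : Set (𝒰 × 𝒱) | IsStepSet E} where
  empty_mem := by
    have := isStepSet_prod (MeasurableSet.empty (α := 𝒰)) (MeasurableSet.empty (α := 𝒱))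
    simpa using this
  compl_mem := by
    rintro _ ⟨ι, _, g, B, hg, hB, rfl⟩
    exact ⟨ι, inferInstance, g, fun i => (B i)ᶜ, hg, fun i => (hB i).compl, rfl⟩
  union_mem := by
    rintro _ _ ⟨ι, _, g, B, hg, hB, rfl⟩ ⟨ι', _, g', B', hg', hB', rfl⟩
    refine ⟨ι × ι', inferInstance, fun u => (g u, g' u), fun i => B i.1 ∪ B' i.2, fun i => ?_,
      fun i => (hB i.1).union (hB' i.2), rfl⟩
    have : (fun u => (g u, g' u)) ⁻¹' {i} = g ⁻¹' {i.1} ∩ g' ⁻¹' {i.2} := by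
      ext u; simp [Prod.ext_iff]
    rw [this]; exact (hg _).inter (hg' _)

lemma generateFrom_isStepSet :
    (inferInstance : MeasurableSpace (𝒰 × 𝒱)) =
      MeasurableSpace.generateFrom {E : Set (𝒰 × 𝒱) | IsStepSet E} := by
  apply le_antisymm
  · rw [← generateFrom_prod]
    apply MeasurableSpace.generateFrom_mono
    rintro _ ⟨s, hs, t, ht, rfl⟩
    exact isStepSet_prod hs ht
  · apply MeasurableSpace.generateFrom_le
    rintro _ ⟨ι, _, g, B, hg, hB, rfl⟩
    rw [stepSet_eq_iUnion]
    exact MeasurableSet.iUnion fun i => (hg i).prod (hB i)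

variable {m₁ m₂ mΩ : MeasurableSpace Ω} {μ : Measure Ω} [IsProbabilityMeasure μ]

/-- For a step set the mixing bound is read off conditionally on `m₁`: on the cell `g ∘ U = i` the
conditional probability of `V ∈ B i` is compared with its unconditional probability. -/
lemma measure_stepSet_le (h₁ : m₁ ≤ mΩ) (h₂ : m₂ ≤ mΩ) {b : ℝ≥0∞}
    (hb : ∀ F : Finset (Set Ω), (∀ B ∈ F, MeasurableSet[m₂] B) →
      ∫⁻ ω, ⨆ B ∈ F, ‖(μ⟦B | m₁⟧) ω - μ.real B‖ₑ ∂μ ≤ b)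
    {U : Ω → 𝒰} {V : Ω → 𝒱} (hU : Measurable[m₁] U) (hV : Measurable[m₂] V)
    {E : Set (𝒰 × 𝒱)} (hE : IsStepSet E) :
    μ.map (fun ω => (U ω, V ω)) E ≤ ((μ.map U).prod (μ.map V)) E + b := by
  classical
  obtain ⟨ι, _, g, B, hg, hB, rfl⟩ := hE
  have hU' : Measurable U := hU.mono h₁ le_rfl
  have hV' : Measurable V := hV.mono h₂ le_rfl
  have : IsProbabilityMeasure (μ.map U) := Measure.isProbabilityMeasure_map hU'.aemeasurable
  have : IsProbabilityMeasure (μ.map V) := Measure.isProbabilityMeasure_map hV'.aemeasurable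
  rw [stepSet_eq_iUnion, measure_iUnion (μ := (μ.map U).prod (μ.map V)) _
    fun i => (hg i).prod (hB i), tsum_fintype]
  swap
  · intro i j hij
    exact Set.disjoint_prod.2 (Or.inl (Disjoint.preimage _ (by simpa using hij)))
  set A : ι → Set Ω := fun i => U ⁻¹' (g ⁻¹' {i})
  set D : ι → Set Ω := fun i => V ⁻¹' (B i)
  have hAm : ∀ i, MeasurableSet[m₁] (A i) := fun i => hU (hg i)
  have hDm : ∀ i, MeasurableSet[m₂] (D i) := fun i => hV (hB i)
  set F : Finset (Set Ω) := Finset.univ.image D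
  set Φ : Ω → ℝ≥0∞ := fun ω => ⨆ C ∈ F, ‖(μ⟦C | m₁⟧) ω - μ.real C‖ₑ
  have hcell : ∀ i, μ (A i ∩ D i) ≤ μ (A i) * μ (D i) + ∫⁻ ω in A i, Φ ω ∂μ := by
    intro i
    have hDi : MeasurableSet (D i) := h₂ _ (hDm i)
    have h1 : ∫ ω in A i, (μ⟦D i | m₁⟧) ω ∂μ = μ.real (A i ∩ D i) := by
      rw [setIntegral_condExp h₁ ((integrable_const (1 : ℝ)).indicator hDi) (hAm i),
        integral_indicator hDi]
      simp [Measure.real, Measure.restrict_restrict hDi,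
        Set.inter_comm]
    calc μ (A i ∩ D i) = ‖∫ ω in A i, (μ⟦D i | m₁⟧) ω ∂μ‖ₑ := by
          rw [h1, Real.enorm_of_nonneg measureReal_nonneg, ofReal_measureReal]
      _ ≤ ∫⁻ ω in A i, ‖(μ⟦D i | m₁⟧) ω‖ₑ ∂μ := enorm_integral_le_lintegral_enorm _
      _ ≤ ∫⁻ ω in A i, (μ (D i) + Φ ω) ∂μ := by
          apply lintegral_mono
          intro ω
          have h2 : ‖(μ⟦D i | m₁⟧) ω‖ₑ ≤ ‖μ.real (D i)‖ₑ + ‖(μ⟦D i | m₁⟧) ω - μ.real (D i)‖ₑ := by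
            refine le_trans (le_of_eq ?_) (enorm_add_le _ _)
            rw [add_sub_cancel]
          refine h2.trans ?_
          rw [Real.enorm_of_nonneg measureReal_nonneg, ofReal_measureReal]
          refine add_le_add le_rfl ?_
          exact le_iSup₂_of_le (D i) (Finset.mem_image_of_mem _ (Finset.mem_univ i)) le_rfl
      _ = μ (A i) * μ (D i) + ∫⁻ ω in A i, Φ ω ∂μ := by
          rw [lintegral_add_left measurable_const]
          simp [mul_comm]
  calc μ.map (fun ω => (U ω, V ω)) (⋃ i, (g ⁻¹' {i}) ×ˢ B i)
      ≤ ∑ i, μ.map (fun ω => (U ω, V ω)) ((g ⁻¹' {i}) ×ˢ B i) := measure_iUnion_fintype_le _ _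
    _ = ∑ i, μ (A i ∩ D i) := by
        refine Finset.sum_congr rfl fun i _ => ?_
        rw [Measure.map_apply (hU'.prodMk hV') ((hg i).prod (hB i))]
        rfl
    _ ≤ ∑ i, (μ (A i) * μ (D i) + ∫⁻ ω in A i, Φ ω ∂μ) := Finset.sum_le_sum fun i _ => hcell i
    _ = ∑ i, μ (A i) * μ (D i) + ∫⁻ ω in ⋃ i, A i, Φ ω ∂μ := by
        rw [Finset.sum_add_distrib, lintegral_iUnion (fun i => h₁ _ (hAm i)), tsum_fintype]
        intro i j hij
        exact Disjoint.preimage _ (Disjoint.preimage _ (by simpa using hij))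
    _ ≤ ∑ i, ((μ.map U).prod (μ.map V)) ((g ⁻¹' {i}) ×ˢ B i) + b := by
        gcongr with i
        · rw [Measure.prod_prod, Measure.map_apply hU' (hg i), Measure.map_apply hV' (hB i)]
        · refine (setLIntegral_le_lintegral _ _).trans (hb F ?_)
          intro C hC
          obtain ⟨i, -, rfl⟩ := Finset.mem_image.1 hC
          exact hDm i

/-- The joint law of an `m₁`-measurable and an `m₂`-measurable variable exceeds the product of the
marginal laws by at most the mixing coefficient, uniformly over measurable sets of pairs. -/
lemma map_prodMk_le_of_mixing (h₁ : m₁ ≤ mΩ) (h₂ : m₂ ≤ mΩ) {b : ℝ≥0∞}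
    (hb : ∀ F : Finset (Set Ω), (∀ B ∈ F, MeasurableSet[m₂] B) →
      ∫⁻ ω, ⨆ B ∈ F, ‖(μ⟦B | m₁⟧) ω - μ.real B‖ₑ ∂μ ≤ b)
    {U : Ω → 𝒰} {V : Ω → 𝒱} (hU : Measurable[m₁] U) (hV : Measurable[m₂] V)
    {E : Set (𝒰 × 𝒱)} (hE : MeasurableSet E) :
    μ.map (fun ω => (U ω, V ω)) E ≤ ((μ.map U).prod (μ.map V)) E + b := by
  have hU' : Measurable U := hU.mono h₁ le_rfl
  have hV' : Measurable V := hV.mono h₂ le_rfl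
  have : IsProbabilityMeasure (μ.map U) := Measure.isProbabilityMeasure_map hU'.aemeasurable
  have : IsProbabilityMeasure (μ.map V) := Measure.isProbabilityMeasure_map hV'.aemeasurable
  have : IsProbabilityMeasure (μ.map fun ω => (U ω, V ω)) :=
    Measure.isProbabilityMeasure_map (hU'.prodMk hV').aemeasurable
  set Q := μ.map (fun ω => (U ω, V ω))
  set P := (μ.map U).prod (μ.map V)
  refine ENNReal.le_of_forall_pos_le_add fun ε hε _ => ?_
  have hε' : (0 : ℝ≥0∞) < ε / 2 := by simpa using hε.ne'
  obtain ⟨A, hA, hlt⟩ := exists_measure_symmDiff_lt_of_generateFrom_isSetRing (μ := Q + P)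
    isSetAlgebra_isStepSet.isSetRing
    ⟨{Set.univ}, Set.countable_singleton _, by
      simpa using isSetAlgebra_isStepSet.univ_mem, by simp⟩
    generateFrom_isStepSet hE hε'
  have hQ : Q (symmDiff A E) ≤ ε / 2 := le_trans (by simp) hlt.le
  have hP : P (symmDiff A E) ≤ ε / 2 := le_trans (by simp) hlt.le
  have key : ∀ (R : Measure (𝒰 × 𝒱)) (s t : Set (𝒰 × 𝒱)), R s ≤ R t + R (symmDiff t s) := by
    intro R s t
    refine (measure_mono ?_).trans (measure_union_le _ _)
    intro x hx
    by_cases h : x ∈ t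
    · exact Or.inl h
    · exact Or.inr (Or.inr ⟨hx, h⟩)
  calc Q E ≤ Q A + ε / 2 := (key Q E A).trans (by gcongr)
    _ ≤ P A + b + ε / 2 := by gcongr; exact measure_stepSet_le h₁ h₂ hb hU hV hA
    _ ≤ P E + ε / 2 + b + ε / 2 := by
        gcongr
        refine (key P A E).trans ?_
        rw [symmDiff_comm]; gcongr
    _ = P E + b + ε := by
        rw [add_right_comm (P E), add_assoc, ENNReal.add_halves]

end Decoupling

/-! ### Maximal inequality for bounded functions -/

section Concentration

variable {Ω 𝒮 : Type*} [MeasurableSpace Ω] [MeasurableSpace 𝒮]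

lemma pastSigma_le {Z : ℤ → Ω → 𝒮} (hZ : ∀ t, Measurable (Z t)) (t : ℤ) :
    pastSigma Z t ≤ ‹MeasurableSpace Ω› :=
  iSup_le fun s => (hZ s).comap_le

lemma futureSigma_le {Z : ℤ → Ω → 𝒮} (hZ : ∀ t, Measurable (Z t)) (t : ℤ) :
    futureSigma Z t ≤ ‹MeasurableSpace Ω› :=
  iSup_le fun s => (hZ s).comap_le

lemma map_eval_eq_of_strictlyStationary {μ : Measure Ω} {Z : ℤ → Ω → 𝒮}
    (hZ : ∀ t, Measurable (Z t)) (h : StrictlyStationary μ Z) (t : ℤ) :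
    μ.map (Z t) = μ.map (Z 0) := by
  have h1 := congrArg (Measure.map (fun z : ℤ → 𝒮 => z 0)) (h t)
  rw [Measure.map_map (measurable_pi_apply _) (measurable_pi_lambda _ fun s => hZ _),
    Measure.map_map (measurable_pi_apply _) (measurable_pi_lambda _ fun s => hZ _)] at h1
  simpa [Function.comp_def] using h1

/-- A sample of `m` observations with spacing `b` is independent up to an error of `m β(b)` in
total variation: peel off the first observation and iterate. -/
lemma map_spaced_sample_le {μ : Measure Ω} [IsProbabilityMeasure μ] {Z : ℤ → Ω → 𝒮}
    (hZ : ∀ t, Measurable (Z t)) {P : Measure 𝒮} [IsProbabilityMeasure P]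
    (hP : ∀ t, μ.map (Z t) = P) (b m : ℕ) :
    ∀ (r : ℤ) {E : Set (Fin m → 𝒮)}, MeasurableSet E →
      μ.map (fun ω (j : Fin m) => Z (r + (j : ℕ) * b) ω) E
        ≤ Measure.pi (fun _ => P) E + m * betaMixing μ Z b := by
  induction m with
  | zero =>
    intro r E hE
    have hmeas : Measurable fun ω (j : Fin 0) => Z (r + (j : ℕ) * b) ω :=
      measurable_pi_lambda _ fun s => hZ _
    rcases Set.eq_empty_or_nonempty E with rfl | ⟨x, hx⟩
    · simp
    · have hE' : E = Set.univ := Set.eq_univ_of_forall fun y => Subsingleton.elim x y ▸ hx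
      rw [hE', Measure.map_apply hmeas MeasurableSet.univ]
      simp
  | succ m ih =>
    intro r E hE
    set e := MeasurableEquiv.piFinSuccAbove (fun _ : Fin (m + 1) => 𝒮) 0
    set U : Ω → 𝒮 := Z r
    set V : Ω → Fin m → 𝒮 := fun ω j => Z (r + b + (j : ℕ) * b) ω with hV
    set E' := e.symm ⁻¹' E with hE'
    have hE'm : MeasurableSet E' := e.symm.measurable hE
    have hVm : Measurable V := measurable_pi_lambda _ fun s => hZ _
    have hEE : E = e ⁻¹' E' := by
      rw [hE', ← Set.preimage_comp]; simp
    have hUV : (fun ω => e (fun j : Fin (m + 1) => Z (r + (j : ℕ) * b) ω))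
        = fun ω => (U ω, V ω) := by
      funext ω
      refine Prod.ext ?_ ?_
      · simp [e, MeasurableEquiv.piFinSuccAbove, U, Fin.insertNthEquiv]
      · funext j
        change Z (r + ((Fin.succAbove 0 j : Fin (m + 1)) : ℕ) * b) ω = Z (r + b + (j : ℕ) * b) ω
        congr 1
        rw [Fin.succAbove_zero, Fin.val_succ]
        push_cast
        ring
    have hVP : IsProbabilityMeasure (μ.map V) := Measure.isProbabilityMeasure_map hVm.aemeasurable
    have h1 : μ.map (fun ω (j : Fin (m + 1)) => Z (r + (j : ℕ) * b) ω) E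
        = μ.map (fun ω => (U ω, V ω)) E' := by
      rw [← hUV, hEE, Measure.map_apply (measurable_pi_lambda _ fun s => hZ _) (e.measurable hE'm),
        Measure.map_apply _ hE'm]
      · rfl
      · exact e.measurable.comp (measurable_pi_lambda _ fun s => hZ _)
    have hU1 : Measurable[pastSigma Z r] U :=
      Measurable.mono (comap_measurable (Z r))
        (le_iSup (fun s : {s : ℤ // s ≤ r} => MeasurableSpace.comap (Z s) inferInstance) ⟨r, le_rfl⟩)
        le_rfl
    have hV1 : Measurable[futureSigma Z (r + b)] V := by
      refine @measurable_pi_lambda _ _ _ (futureSigma Z (r + b)) _ _ fun j => ?_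
      refine Measurable.mono (comap_measurable (Z _))
        (le_iSup (fun s : {s : ℤ // r + b ≤ s} => MeasurableSpace.comap (Z s) inferInstance)
          ⟨r + b + (j : ℕ) * b, ?_⟩) le_rfl
      have : (0 : ℤ) ≤ (j : ℕ) * b := by positivity
      linarith
    have h2 : μ.map (fun ω => (U ω, V ω)) E'
        ≤ ((μ.map U).prod (μ.map V)) E' + betaMixing μ Z b := by
      refine map_prodMk_le_of_mixing (pastSigma_le hZ r) (futureSigma_le hZ (r + b))
        (fun F hF => ?_) hU1 hV1 hE'm
      unfold betaMixing
      exact le_iSup_of_le r (le_iSup₂_of_le F hF le_rfl)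
    rw [h1]
    refine h2.trans ?_
    have h3 : ((μ.map U).prod (μ.map V)) E'
        ≤ (P.prod (Measure.pi fun _ : Fin m => P)) E' + m * betaMixing μ Z b := by
      rw [hP r, Measure.prod_apply hE'm, Measure.prod_apply hE'm]
      calc ∫⁻ u, μ.map V (Prod.mk u ⁻¹' E') ∂P
          ≤ ∫⁻ u, (Measure.pi (fun _ : Fin m => P) (Prod.mk u ⁻¹' E')
              + m * betaMixing μ Z b) ∂P :=
            lintegral_mono fun u => ih (r + b) (measurable_prodMk_left hE'm)
        _ = _ := by
            rw [lintegral_add_right _ measurable_const]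
            simp
    have h4 : (P.prod (Measure.pi fun _ : Fin m => P)) E' = Measure.pi (fun _ => P) E := by
      have := (measurePreserving_piFinSuccAbove (fun _ : Fin (m + 1) => P) 0).measure_preimage
        hE'm.nullMeasurableSet
      rw [← this, hEE]
    rw [h4] at h3
    calc _ ≤ Measure.pi (fun _ => P) E + m * betaMixing μ Z b + betaMixing μ Z b := by gcongr
      _ = _ := by push_cast; ring

/-- Exponential tail bound for independent bounded variables whose means and second moments are at
most `s`; the moment generating function is only needed at `1`, where `eˣ ≤ 1 + x + x²`. -/
lemma pi_sum_tail_le {P : Measure 𝒮} [IsProbabilityMeasure P] {m : ℕ} {g : Fin m → 𝒮 → ℝ}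
    (hg : ∀ k, Measurable (g k)) (hb : ∀ k x, |g k x| ≤ 1) {s : ℝ}
    (hm : ∀ k, ∫ x, g k x ∂P ≤ s) (hv : ∀ k, ∫ x, g k x ^ 2 ∂P ≤ s) (τ : ℝ) :
    Measure.pi (fun _ : Fin m => P) {x | τ < ∑ k, g k (x k)}
      ≤ ENNReal.ofReal (Real.exp (2 * m * s - τ)) := by
  have hint : ∀ k, Integrable (g k) P := fun k =>
    Integrable.of_bound (hg k).aestronglyMeasurable 1 (ae_of_all _ fun x => hb k x)
  have hint2 : ∀ k, Integrable (fun x => g k x ^ 2) P := fun k =>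
    Integrable.of_bound ((hg k).pow_const 2).aestronglyMeasurable 1 (ae_of_all _ fun x => by
      rw [Real.norm_eq_abs, abs_pow]; exact pow_le_one₀ (abs_nonneg _) (hb k x))
  have hexp : ∀ k, ∫ x, Real.exp (g k x) ∂P ≤ Real.exp (2 * s) := by
    intro k
    calc ∫ x, Real.exp (g k x) ∂P ≤ ∫ x, (1 + g k x + g k x ^ 2) ∂P := by
          refine integral_mono_of_nonneg (ae_of_all _ fun x => (Real.exp_pos _).le)
            (((integrable_const _).add (hint k)).add (hint2 k)) (ae_of_all _ fun x => ?_)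
          have := (abs_le.1 (Real.abs_exp_sub_one_sub_id_le (hb k x))).2
          simp only
          linarith
      _ = 1 + ∫ x, g k x ∂P + ∫ x, g k x ^ 2 ∂P := by
          rw [integral_add (f := fun x => 1 + g k x) ((integrable_const _).add (hint k)) (hint2 k),
            integral_add (integrable_const _) (hint k)]
          simp
      _ ≤ 2 * s + 1 := by linarith [hm k, hv k]
      _ ≤ Real.exp (2 * s) := Real.add_one_le_exp _
  set Q := Measure.pi (fun _ : Fin m => P)
  have hprod : ∫ x : Fin m → 𝒮, (∏ k, Real.exp (g k (x k))) ∂Q ≤ Real.exp (2 * m * s) := by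
    rw [integral_fintype_prod_eq_prod (μ := fun _ : Fin m => P) (fun k x => Real.exp (g k x))]
    calc (∏ k, ∫ x, Real.exp (g k x) ∂P) ≤ ∏ _k : Fin m, Real.exp (2 * s) :=
          Finset.prod_le_prod (fun k _ => integral_nonneg fun x => (Real.exp_pos _).le)
            fun k _ => hexp k
      _ = Real.exp (2 * m * s) := by
          rw [Finset.prod_const, Finset.card_univ, Fintype.card_fin, ← Real.exp_nat_mul]
          ring_nf
  have hmeas : Measurable fun x : Fin m → 𝒮 => ∑ k, g k (x k) :=
    Finset.measurable_sum _ fun k _ => (hg k).comp (measurable_pi_apply k)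
  have hbd : ∀ x : Fin m → 𝒮, ‖∑ k, g k (x k)‖ ≤ m := fun x =>
    (norm_sum_le _ _).trans ((Finset.sum_le_sum fun k _ => hb k (x k)).trans (by simp))
  have hI : Integrable (fun x : Fin m → 𝒮 => Real.exp (1 * ∑ k, g k (x k))) Q := by
    refine Integrable.of_bound 
      (Real.measurable_exp.comp (hmeas.const_mul 1)).aestronglyMeasurable (Real.exp m) (ae_of_all _ fun x => ?_)
    rw [Real.norm_eq_abs, Real.abs_exp, one_mul]
    exact Real.exp_le_exp.2 ((le_abs_self _).trans (hbd x))
  have hmark := measure_ge_le_exp_mul_mgf (μ := Q) (X := fun x => ∑ k, g k (x k)) τ zero_le_one hI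
  have hmgf : mgf (fun x : Fin m → 𝒮 => ∑ k, g k (x k)) Q 1 ≤ Real.exp (2 * m * s) := by
    unfold mgf
    simpa [Real.exp_sum] using hprod
  calc Q {x | τ < ∑ k, g k (x k)} ≤ Q {x | τ ≤ ∑ k, g k (x k)} :=
        measure_mono fun x (hx : τ < _) => hx.le
    _ = ENNReal.ofReal (Q.real {x | τ ≤ ∑ k, g k (x k)}) := by rw [ofReal_measureReal]
    _ ≤ ENNReal.ofReal (Real.exp (2 * m * s - τ)) := by
        refine ENNReal.ofReal_le_ofReal (hmark.trans ?_)
        calc _ ≤ Real.exp (-1 * τ) * Real.exp (2 * m * s) := by gcongr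
          _ = _ := by rw [← Real.exp_add]; ring_nf

lemma sum_Icc_eq_sum_residues {M : Type*} [AddCommMonoid M] (F : ℕ → M) {n b m : ℕ} (hb : 0 < b)
    (hn : n ≤ m * b) :
    ∑ t ∈ Finset.Icc 1 n, F t
      = ∑ r ∈ Finset.range b, ∑ k ∈ Finset.range m,
          if 1 + r + k * b ≤ n then F (1 + r + k * b) else 0 := by
  rw [← Finset.sum_product', ← Finset.sum_filter]
  refine Finset.sum_nbij' (fun t => ((t - 1) % b, (t - 1) / b)) (fun z => 1 + z.1 + z.2 * b)
    ?_ ?_ ?_ ?_ ?_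
  · intro t ht
    rw [Finset.mem_Icc] at ht
    have h1 := Nat.mod_lt (t - 1) hb
    have h2 : (t - 1) / b < m := by
      rw [Nat.div_lt_iff_lt_mul hb]; omega
    have h3 := Nat.mod_add_div' (t - 1) b
    simp only [Finset.mem_filter, Finset.mem_product, Finset.mem_range]
    exact ⟨⟨h1, h2⟩, by omega⟩
  · intro z hz
    simp only [Finset.mem_filter, Finset.mem_product, Finset.mem_range] at hz
    rw [Finset.mem_Icc]
    omega
  · intro t ht
    rw [Finset.mem_Icc] at ht
    have h3 := Nat.mod_add_div' (t - 1) b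
    simp only
    omega
  · intro z hz
    simp only [Finset.mem_filter, Finset.mem_product, Finset.mem_range] at hz
    have h : 1 + z.1 + z.2 * b - 1 = z.1 + z.2 * b := by omega
    simp only [h]
    refine Prod.ext ?_ ?_
    · simp [Nat.mod_eq_of_lt hz.1.1]
    · simp only
      rw [Nat.add_mul_div_right _ _ hb, Nat.div_eq_of_lt hz.1.1, zero_add]
  · intro t ht
    rw [Finset.mem_Icc] at ht
    have h3 := Nat.mod_add_div' (t - 1) b
    simp only
    congr 1
    omega

/-- Maximal inequality for a finite family of bounded functions of a `β`-mixing sequence. The sample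
is split into its `b` residue classes modulo `b`; each class is decoupled, at a cost `m β(b)` that
does not depend on the size of the family, and is then treated as an independent sample. -/
lemma mixing_maximal_inequality {μ : Measure Ω} [IsProbabilityMeasure μ] {Z : ℤ → Ω → 𝒮}
    (hZ : ∀ t, Measurable (Z t)) {P : Measure 𝒮} [IsProbabilityMeasure P]
    (hP : ∀ t, μ.map (Z t) = P) {I : Type*} [Fintype I] {f : I → 𝒮 → ℝ}
    (hf : ∀ i, Measurable (f i)) (hf1 : ∀ i x, |f i x| ≤ 1) {s : ℝ}
    (hm : ∀ i, |∫ x, f i x ∂P| ≤ s) (hv : ∀ i, ∫ x, f i x ^ 2 ∂P ≤ s)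
    {n b m : ℕ} (hb : 0 < b) (hn : n ≤ m * b) (τ : ℝ) :
    μ {ω | ∃ i, b * τ < |∑ t ∈ Finset.Icc 1 n, f i (Z (t : ℤ) ω)|}
      ≤ b * (Fintype.card I * (2 * ENNReal.ofReal (Real.exp (2 * m * s - τ)))
          + m * betaMixing μ Z b) := by
  set g : I → ℕ → Fin m → 𝒮 → ℝ := fun i r k x => if 1 + r + (k : ℕ) * b ≤ n then f i x else 0
    with hg
  have hs : ∀ _ : I, 0 ≤ s := fun i => (abs_nonneg _).trans (hm i)
  have hgm : ∀ i r k, Measurable (g i r k) := by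
    intro i r k
    simp only [hg]
    split_ifs
    exacts [hf i, measurable_const]
  have hg1 : ∀ i r k x, |g i r k x| ≤ 1 := by
    intro i r k x
    simp only [hg]
    split_ifs
    exacts [hf1 i x, by simp]
  have hgi : ∀ i r k, |∫ x, g i r k x ∂P| ≤ s := by
    intro i r k
    simp only [hg]
    split_ifs
    exacts [hm i, by simpa using hs i]
  have hg2 : ∀ i r k, ∫ x, g i r k x ^ 2 ∂P ≤ s := by
    intro i r k
    simp only [hg]
    split_ifs
    exacts [hv i, by simpa using hs i]
  set E : ℕ → Set (Fin m → 𝒮) := fun r =>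
    ⋃ i, ({x | τ < ∑ k, g i r k (x k)} ∪ {x | τ < ∑ k, -g i r k (x k)}) with hE
  have hEm : ∀ r, MeasurableSet (E r) := by
    intro r
    refine MeasurableSet.iUnion fun i => MeasurableSet.union ?_ ?_
    · exact measurableSet_lt measurable_const
        (Finset.measurable_sum _ fun k _ => (hgm i r k).comp (measurable_pi_apply k))
    · exact measurableSet_lt measurable_const
        (Finset.measurable_sum _ fun k _ => ((hgm i r k).comp (measurable_pi_apply k)).neg)
  have hEpi : ∀ r, Measure.pi (fun _ : Fin m => P) (E r)
      ≤ Fintype.card I * (2 * ENNReal.ofReal (Real.exp (2 * m * s - τ))) := by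
    intro r
    refine (measure_iUnion_fintype_le _ _).trans ?_
    calc _ ≤ ∑ _i : I, 2 * ENNReal.ofReal (Real.exp (2 * m * s - τ)) := by
          refine Finset.sum_le_sum fun i _ => (measure_union_le _ _).trans ?_
          rw [two_mul]
          refine add_le_add ?_ ?_
          · exact pi_sum_tail_le (hgm i r) (hg1 i r) (fun k => (abs_le.1 (hgi i r k)).2)
              (hg2 i r) τ
          · refine pi_sum_tail_le (g := fun k x => -g i r k x) (fun k => (hgm i r k).neg)
              (fun k x => by rw [abs_neg]; exact hg1 i r k x) (fun k => ?_) (fun k => ?_) τ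
            · rw [integral_neg]; linarith [(abs_le.1 (hgi i r k)).1]
            · simpa using hg2 i r k
      _ = _ := by simp
  have hsub : {ω | ∃ i, b * τ < |∑ t ∈ Finset.Icc 1 n, f i (Z (t : ℤ) ω)|}
      ⊆ ⋃ r ∈ Finset.range b,
        (fun ω (j : Fin m) => Z ((1 + r : ℤ) + (j : ℕ) * b) ω) ⁻¹' E r := by
    rintro ω ⟨i, hi⟩
    by_contra hcon
    simp only [Set.mem_iUnion, not_exists, Set.mem_preimage, hE, Set.mem_union, Set.mem_ofPred_eq,
      not_or, not_lt, Finset.mem_range] at hcon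
    have hdec := sum_Icc_eq_sum_residues (fun t : ℕ => f i (Z (t : ℤ) ω)) hb hn
    rw [hdec] at hi
    refine absurd hi (not_lt.2 ?_)
    calc _ ≤ ∑ r ∈ Finset.range b, |∑ k ∈ Finset.range m,
          if 1 + r + k * b ≤ n then f i (Z ((1 + r + k * b : ℕ) : ℤ) ω) else 0| :=
          Finset.abs_sum_le_sum_abs _ _
      _ ≤ ∑ _r ∈ Finset.range b, τ := by
          refine Finset.sum_le_sum fun r hr => ?_
          obtain ⟨h1, h2⟩ := hcon r (Finset.mem_range.1 hr) i
          rw [Finset.sum_neg_distrib] at h2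
          rw [Finset.sum_range (n := m)]
          refine abs_le.2 ⟨?_, ?_⟩
          · have := neg_le_neg h2
            rw [neg_neg] at this
            simpa [hg] using this
          · simpa [hg] using h1
      _ = b * τ := by simp
  refine (measure_mono hsub).trans ((measure_biUnion_finset_le _ _).trans ?_)
  calc _ ≤ ∑ _r ∈ Finset.range b, (Fintype.card I *
          (2 * ENNReal.ofReal (Real.exp (2 * m * s - τ))) + m * betaMixing μ Z b) := by
        refine Finset.sum_le_sum fun r _ => ?_
        rw [← Measure.map_apply (measurable_pi_lambda _ fun s => hZ _) (hEm r)]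
        exact (map_spaced_sample_le hZ hP b m (1 + r : ℤ) (hEm r)).trans
          (add_le_add (hEpi r) le_rfl)
    _ = _ := by simp [mul_add]

end Concentration

/-! ### Truncation at the envelope -/

section Truncation

variable {Ω 𝒮 : Type*} [MeasurableSpace Ω] [MeasurableSpace 𝒮]

lemma integral_le_of_ofReal_le {P : Measure 𝒮} {F : 𝒮 → ℝ} (hF : Measurable F) (hF0 : ∀ x, 0 ≤ F x)
    {G : 𝒮 → ℝ≥0∞} (hFG : ∀ x, ENNReal.ofReal (F x) ≤ G x) {s : ℝ} (hs : 0 ≤ s)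
    (hG : ∫⁻ x, G x ∂P ≤ ENNReal.ofReal s) : ∫ x, F x ∂P ≤ s := by
  rw [integral_eq_lintegral_of_nonneg_ae (ae_of_all _ hF0) hF.aestronglyMeasurable]
  exact ENNReal.toReal_le_of_le_ofReal hs ((lintegral_mono hFG).trans hG)

lemma enorm_sq_eq_ofReal (x : ℝ) : ‖x‖ₑ ^ 2 = ENNReal.ofReal (x ^ 2) := by
  rw [← sq_abs, ENNReal.ofReal_pow (abs_nonneg x), Real.enorm_eq_ofReal_abs]

/-- Maximal inequality for an arbitrary class `W` with an envelope `G` of small mean, finitely many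
representatives `V`, and oscillations around them of mean square at most `ε²`. Only a second moment
of the envelope is available: the part of `W` where `G > 1` is bounded by `G` and handled by
Markov's inequality, and what remains is handled by the maximal inequality for bounded functions,
applied to the truncated representatives and to truncated bounds for the oscillations. -/
lemma mixing_maximal_inequality_of_envelope {μ : Measure Ω} [IsProbabilityMeasure μ]
    {Z : ℤ → Ω → 𝒮} (hZ : ∀ t, Measurable (Z t)) {P : Measure 𝒮} [IsProbabilityMeasure P]
    (hP : ∀ t, μ.map (Z t) = P) {J I : Type*} [Fintype I] {W : J → 𝒮 → ℝ} {V : I → 𝒮 → ℝ}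
    {G : 𝒮 → ℝ≥0∞} {D : I → 𝒮 → ℝ≥0∞} {s ε : ℝ} (hs : 0 < s) (hε : 0 < ε) (hεs : ε ≤ s)
    (hG : Measurable G) (hGs : ∫⁻ x, G x ∂P ≤ ENNReal.ofReal s)
    (hWG : ∀ j x, ‖W j x‖ₑ ^ 2 ≤ G x) (hV : ∀ i, Measurable (V i))
    (hVG : ∀ i x, ‖V i x‖ₑ ^ 2 ≤ G x) (hV0 : ∀ i, ∫ x, V i x ∂P = 0)
    (hD : ∀ i, Measurable (D i)) (hDε : ∀ i, ∫⁻ x, D i x ∂P ≤ ENNReal.ofReal (ε ^ 2))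
    (hWV : ∀ j, ∃ i, ∀ x, ‖W j x - V i x‖ₑ ^ 2 ≤ D i x)
    {n b m : ℕ} (hb : 0 < b) (hn : n ≤ m * b) (τ : ℝ) {K : ℝ} (hK : 0 < K) :
    μ {ω | ∃ j, 3 * (b * τ) + K < |∑ t ∈ Finset.Icc 1 n, W j (Z (t : ℤ) ω)|}
      ≤ ENNReal.ofReal (n * s / K)
        + b * ((2 * Fintype.card I : ℕ) * (2 * ENNReal.ofReal (Real.exp (2 * m * s - τ)))
          + m * betaMixing μ Z b) := by
  classical
  set f : I → 𝒮 → ℝ := fun i x => if G x ≤ 1 then V i x else 0 with hf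
  set H : I → 𝒮 → ℝ≥0∞ := fun i x =>
    min 1 ((ENNReal.ofReal ε + D i x / ENNReal.ofReal ε) / 4) with hH
  set h : I → 𝒮 → ℝ := fun i x => (H i x).toReal with hh
  have hHm : ∀ i, Measurable (H i) := fun i =>
    measurable_const.min ((((hD i).div_const _).const_add _).div_const _)
  have hH1 : ∀ i x, H i x ≤ 1 := fun i x => min_le_left _ _
  have hh0 : ∀ i x, 0 ≤ h i x := fun i x => ENNReal.toReal_nonneg
  have hh1 : ∀ i x, h i x ≤ 1 := fun i x =>
    ENNReal.toReal_le_of_le_ofReal zero_le_one (by simpa using hH1 i x)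
  have hhof : ∀ i x, ENNReal.ofReal (h i x) = H i x := fun i x =>
    ENNReal.ofReal_toReal (ne_top_of_le_ne_top ENNReal.one_ne_top (hH1 i x))
  have hhm : ∀ i, Measurable (h i) := fun i => (hHm i).ennreal_toReal
  have hHint : ∀ i, ∫⁻ x, H i x ∂P ≤ ENNReal.ofReal s := by
    intro i
    calc ∫⁻ x, H i x ∂P ≤ ∫⁻ x, (ENNReal.ofReal ε + D i x / ENNReal.ofReal ε) / 4 ∂P :=
          lintegral_mono fun x => min_le_right _ _
      _ = (ENNReal.ofReal ε + (∫⁻ x, D i x ∂P) / ENNReal.ofReal ε) / 4 := by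
          simp_rw [div_eq_mul_inv]
          rw [lintegral_mul_const _ (((hD i).mul_const _).const_add _),
            lintegral_add_left measurable_const, lintegral_mul_const _ (hD i)]
          simp
      _ ≤ (ENNReal.ofReal ε + ENNReal.ofReal (ε ^ 2) / ENNReal.ofReal ε) / 4 := by
          gcongr; exact hDε i
      _ = ENNReal.ofReal ((ε + ε ^ 2 / ε) / 4) := by
          rw [← ENNReal.ofReal_div_of_pos hε, ← ENNReal.ofReal_add hε.le (by positivity),
            ENNReal.ofReal_div_of_pos (by norm_num)]
          simp
      _ ≤ ENNReal.ofReal s := by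
          refine ENNReal.ofReal_le_ofReal ?_
          have : ε ^ 2 / ε = ε := by field_simp
          rw [this]; linarith
  have hVle : ∀ i x, G x ≤ 1 → |V i x| ≤ 1 := by
    intro i x hx
    have h1 := (hVG i x).trans hx
    rw [enorm_sq_eq_ofReal, ENNReal.ofReal_le_one, sq_le_one_iff_abs_le_one] at h1
    exact h1
  -- off the event `G ≤ 1` the envelope bounds the function itself, not only its square
  have hlarge : ∀ (y : ℝ) x, ‖y‖ₑ ^ 2 ≤ G x → ¬ G x ≤ 1 → ‖y‖ₑ ≤ G x := by
    intro y x hy hx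
    rcases le_total ‖y‖ₑ 1 with h1 | h1
    · exact h1.trans (not_le.1 hx).le
    · exact (le_self_pow h1 two_ne_zero).trans hy
  have hfm : ∀ i, Measurable (f i) := fun i =>
    Measurable.ite (measurableSet_le hG measurable_const) (hV i) measurable_const
  have hf1 : ∀ i x, |f i x| ≤ 1 := by
    intro i x
    simp only [hf]
    split_ifs with hx
    exacts [hVle i x hx, by simp]
  have hVint : ∀ i, Integrable (V i) P := by
    intro i
    refine MemLp.integrable (q := 2) one_le_two ⟨(hV i).aestronglyMeasurable, ?_⟩
    rw [eLpNorm_lt_top_iff_lintegral_rpow_enorm_lt_top two_ne_zero ENNReal.ofNat_ne_top]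
    refine lt_of_le_of_lt (lintegral_mono fun x => ?_) (hGs.trans_lt ENNReal.ofReal_lt_top)
    simpa using hVG i x
  have hfint : ∀ i, Integrable (f i) P := fun i =>
    Integrable.of_bound (hfm i).aestronglyMeasurable 1 (ae_of_all _ (hf1 i))
  have hfmean : ∀ i, |∫ x, f i x ∂P| ≤ s := by
    intro i
    have h1 : ∫ x, f i x ∂P = ∫ x, (f i x - V i x) ∂P := by
      rw [integral_sub (hfint i) (hVint i), hV0 i, sub_zero]
    rw [h1]
    refine (abs_integral_le_integral_abs).trans ?_
    refine integral_le_of_ofReal_le (F := fun x => |f i x - V i x|) (((hfm i).sub (hV i)).abs)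
      (fun x => abs_nonneg _) (fun x => ?_) hs.le hGs
    simp only [hf]
    split_ifs with hx
    · simp
    · rw [zero_sub, abs_neg, ← Real.enorm_eq_ofReal_abs]
      exact hlarge _ _ (hVG i x) hx
  have hfsq : ∀ i, ∫ x, f i x ^ 2 ∂P ≤ s := by
    intro i
    refine integral_le_of_ofReal_le ((hfm i).pow_const 2) (fun x => sq_nonneg _)
      (fun x => ?_) hs.le hGs
    simp only [hf]
    split_ifs with hx
    · rw [← enorm_sq_eq_ofReal]; exact hVG i x
    · simp
  have hhmean : ∀ i, ∫ x, h i x ∂P ≤ s := fun i =>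
    integral_le_of_ofReal_le (hhm i) (hh0 i) (fun x => (hhof i x).le) hs.le (hHint i)
  have hhsq : ∀ i, ∫ x, h i x ^ 2 ∂P ≤ s := fun i =>
    integral_le_of_ofReal_le ((hhm i).pow_const 2) (fun x => sq_nonneg _)
      (fun x => (ENNReal.ofReal_le_ofReal (pow_le_of_le_one (hh0 i x) (hh1 i x) two_ne_zero)).trans
        (hhof i x).le) hs.le (hHint i)
  have hmax := mixing_maximal_inequality (μ := μ) hZ hP (I := I ⊕ I) (f := Sum.elim f h)
    (by rintro (i | i); exacts [hfm i, hhm i])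
    (by rintro (i | i) x
        exacts [hf1 i x, by simpa [abs_of_nonneg (hh0 i x)] using hh1 i x]) (s := s)
    (by rintro (i | i)
        exacts [hfmean i, (abs_of_nonneg (integral_nonneg (μ := P) fun x => hh0 i x)).trans_le (hhmean i)])
    (by rintro (i | i); exacts [hfsq i, hhsq i]) hb hn τ
  have hmarkov : μ {ω | ENNReal.ofReal K ≤ ∑ t ∈ Finset.Icc 1 n, G (Z (t : ℤ) ω)}
      ≤ ENNReal.ofReal (n * s / K) := by
    have hm : Measurable fun ω => ∑ t ∈ Finset.Icc 1 n, G (Z (t : ℤ) ω) :=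
      Finset.measurable_sum _ fun t _ => hG.comp (hZ _)
    refine (meas_ge_le_lintegral_div hm.aemeasurable (by simpa using hK)
      ENNReal.ofReal_ne_top).trans ?_
    rw [ENNReal.ofReal_div_of_pos hK]
    gcongr
    rw [lintegral_finsetSum (f := fun (t : ℕ) ω => G (Z (t : ℤ) ω)) _ fun t _ => hG.comp (hZ _)]
    calc _ ≤ ∑ _t ∈ Finset.Icc 1 n, ENNReal.ofReal s := by
          refine Finset.sum_le_sum fun t _ => ?_
          rw [← lintegral_map hG (hZ _), hP]
          exact hGs
      _ = ENNReal.ofReal (n * s) := by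
          rw [ENNReal.ofReal_mul (by positivity)]; simp
  refine le_trans (measure_mono (t := {ω | ENNReal.ofReal K ≤ ∑ t ∈ Finset.Icc 1 n, G (Z (t : ℤ) ω)}
    ∪ {ω | ∃ i, b * τ < |∑ t ∈ Finset.Icc 1 n, Sum.elim f h i (Z (t : ℤ) ω)|}) ?_)
    ((measure_union_le _ _).trans (add_le_add hmarkov (hmax.trans (le_of_eq ?_))))
  swap
  · simp [two_mul]
  rintro ω ⟨j, hj⟩
  by_contra hcon
  simp only [Set.mem_union, Set.mem_ofPred_eq, not_or, not_exists, not_lt, not_le] at hcon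
  obtain ⟨hGK, hfh⟩ := hcon
  obtain ⟨i, hi⟩ := hWV j
  have hGt : ∀ t ∈ Finset.Icc 1 n, G (Z (t : ℤ) ω) ≠ ∞ := fun t ht =>
    (ENNReal.sum_lt_top.1 (hGK.trans ENNReal.ofReal_lt_top) t ht).ne
  have hpt : ∀ t ∈ Finset.Icc 1 n, |W j (Z (t : ℤ) ω) - f i (Z (t : ℤ) ω)|
      ≤ (G (Z (t : ℤ) ω)).toReal + 2 * h i (Z (t : ℤ) ω) := by
    intro t ht
    set x := Z (t : ℤ) ω
    simp only [hf]
    split_ifs with hx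
    · have h1 : |W j x - V i x| ≤ 2 * h i x := by
        have hW1 : |W j x| ≤ 1 := by
          have h1 := (hWG j x).trans hx
          rwa [enorm_sq_eq_ofReal, ENNReal.ofReal_le_one, sq_le_one_iff_abs_le_one] at h1
        have hV1 := hVle i x hx
        have h2 : |W j x - V i x| ≤ 2 := (abs_sub _ _).trans (by linarith)
        have h3 : ENNReal.ofReal (|W j x - V i x| / 2) ≤ H i x := by
          refine le_min (ENNReal.ofReal_le_one.2 (by linarith)) ?_
          -- arithmetic and geometric means: `2 v ≤ ε + v² / ε`
          set v := |W j x - V i x|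
          have h4 : v / 2 ≤ (ε + v ^ 2 / ε) / 4 := by
            have : 2 * v ≤ ε + v ^ 2 / ε := by
              rw [← sub_nonneg]
              have : ε + v ^ 2 / ε - 2 * v = (ε - v) ^ 2 / ε := by field_simp; ring
              rw [this]; positivity
            linarith
          refine (ENNReal.ofReal_le_ofReal h4).trans ?_
          rw [ENNReal.ofReal_div_of_pos (by norm_num), ENNReal.ofReal_add hε.le (by positivity),
            ENNReal.ofReal_div_of_pos hε]
          simp only [ENNReal.ofReal_ofNat]
          gcongr
          rw [sq_abs, ← enorm_sq_eq_ofReal]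
          exact hi x
        rw [← hhof, ENNReal.ofReal_le_ofReal_iff (hh0 i x)] at h3
        linarith
      linarith [ENNReal.toReal_nonneg (a := G x)]
    · have h1 := hlarge _ _ (hWG j x) hx
      rw [Real.enorm_eq_ofReal_abs, ENNReal.ofReal_le_iff_le_toReal (hGt t ht)] at h1
      rw [sub_zero]
      linarith [hh0 i x]
  have hsum : |∑ t ∈ Finset.Icc 1 n, W j (Z (t : ℤ) ω)|
      ≤ |∑ t ∈ Finset.Icc 1 n, f i (Z (t : ℤ) ω)| + ∑ t ∈ Finset.Icc 1 n, (G (Z (t : ℤ) ω)).toReal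
        + 2 * ∑ t ∈ Finset.Icc 1 n, h i (Z (t : ℤ) ω) := by
    have h1 := (Finset.abs_sum_le_sum_abs _ _).trans (Finset.sum_le_sum hpt)
    rw [Finset.sum_sub_distrib, Finset.sum_add_distrib, ← Finset.mul_sum] at h1
    have h2 := abs_sub_abs_le_abs_sub (∑ t ∈ Finset.Icc 1 n, W j (Z (t : ℤ) ω))
      (∑ t ∈ Finset.Icc 1 n, f i (Z (t : ℤ) ω))
    linarith
  have hGsum : ∑ t ∈ Finset.Icc 1 n, (G (Z (t : ℤ) ω)).toReal ≤ K := by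
    rw [← ENNReal.toReal_sum hGt]
    exact ENNReal.toReal_le_of_le_ofReal hK.le hGK.le
  have hf' := hfh (Sum.inl i)
  have hh' := (le_abs_self _).trans (hfh (Sum.inr i))
  simp only [Sum.elim_inl, Sum.elim_inr] at hf' hh'
  have hj' : 3 * (b * τ) + K < |∑ t ∈ Finset.Icc 1 n, W j (Z (t : ℤ) ω)| := hj
  linarith

end Truncation

/-! ### Finite nets of parameters -/

section Covering

variable {d q : ℕ} {w : ℝ}

lemma weightedSupNorm_add_le (h g : EuclideanSpace ℝ (Fin q) → ℝ) :
    weightedSupNorm w (h + g) ≤ weightedSupNorm w h + weightedSupNorm w g := by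
  refine iSup_le fun s => ?_
  have h0 : 0 ≤ (1 + ‖s‖ ^ 2) ^ (-w / 2) := by positivity
  calc ENNReal.ofReal (|(h + g) s| * (1 + ‖s‖ ^ 2) ^ (-w / 2))
      ≤ ENNReal.ofReal (|h s| * (1 + ‖s‖ ^ 2) ^ (-w / 2) + |g s| * (1 + ‖s‖ ^ 2) ^ (-w / 2)) := by
        refine ENNReal.ofReal_le_ofReal ?_
        rw [← add_mul]
        exact mul_le_mul_of_nonneg_right (abs_add_le _ _) h0
    _ = ENNReal.ofReal (|h s| * (1 + ‖s‖ ^ 2) ^ (-w / 2))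
          + ENNReal.ofReal (|g s| * (1 + ‖s‖ ^ 2) ^ (-w / 2)) :=
        ENNReal.ofReal_add (by positivity) (by positivity)
    _ ≤ _ := add_le_add (le_iSup (fun s => ENNReal.ofReal (|h s| * (1 + ‖s‖ ^ 2) ^ (-w / 2))) s)
        (le_iSup (fun s => ENNReal.ofReal (|g s| * (1 + ‖s‖ ^ 2) ^ (-w / 2))) s)

lemma weightedSupNorm_neg (h : EuclideanSpace ℝ (Fin q) → ℝ) :
    weightedSupNorm w (-h) = weightedSupNorm w h := by
  simp [weightedSupNorm]

lemma weightedSupNorm_smul_le (x : ℝ) (h : EuclideanSpace ℝ (Fin q) → ℝ) :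
    weightedSupNorm w (x • h) ≤ ‖x‖ₑ * weightedSupNorm w h := by
  refine iSup_le fun s => ?_
  refine le_trans (le_of_eq ?_) (mul_le_mul_right
    (le_iSup (fun s => ENNReal.ofReal (|h s| * (1 + ‖s‖ ^ 2) ^ (-w / 2))) s) _)
  rw [Real.enorm_eq_ofReal_abs, ← ENNReal.ofReal_mul (abs_nonneg x)]
  simp [abs_mul, mul_assoc]

lemma strongNorm_add_le (α β : Param d q) :
    strongNorm w (α + β) ≤ strongNorm w α + strongNorm w β := by
  unfold strongNorm
  calc _ ≤ (‖α.1‖ₑ + ‖β.1‖ₑ) + (weightedSupNorm w α.2 + weightedSupNorm w β.2) :=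
        add_le_add (enorm_add_le _ _) (weightedSupNorm_add_le _ _)
    _ = _ := by ring

lemma strongNorm_smul_le (x : ℝ) (α : Param d q) :
    strongNorm w (x • α) ≤ ‖x‖ₑ * strongNorm w α := by
  unfold strongNorm
  rw [mul_add]
  exact add_le_add (by rw [Prod.smul_fst, enorm_smul]) (weightedSupNorm_smul_le _ _)

lemma exists_finset_card_le_coveringNumber {δ : ℝ} {H : Set (EuclideanSpace ℝ (Fin q) → ℝ)}
    (h : coveringNumber w δ H ≠ ⊤) :
    ∃ T : Finset (EuclideanSpace ℝ (Fin q) → ℝ),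
      (∀ h ∈ H, ∃ g ∈ T, weightedSupNorm w (h - g) ≤ ENNReal.ofReal δ) ∧
        (T.card : ℕ∞) ≤ coveringNumber w δ H := by
  have h1 : coveringNumber w δ H < coveringNumber w δ H + 1 := ENat.lt_add_one_iff h |>.2 le_rfl
  conv_lhs at h1 => unfold coveringNumber
  simp only [iInf_lt_iff] at h1
  obtain ⟨T, hT, hlt⟩ := h1
  exact ⟨T, hT, (ENat.lt_add_one_iff h).1 hlt⟩

lemma norm_sub_le_of_coord {e : ℝ} (he : 0 ≤ e) {θ θ' : EuclideanSpace ℝ (Fin d)}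
    (h : ∀ i, |θ i - θ' i| ≤ e) : ‖θ - θ'‖ ≤ d * e := by
  rw [EuclideanSpace.norm_eq]
  refine Real.sqrt_le_iff.2 ⟨by positivity, ?_⟩
  calc ∑ i, ‖(θ - θ') i‖ ^ 2 ≤ ∑ _i : Fin d, e ^ 2 := by
        refine Finset.sum_le_sum fun i _ => ?_
        exact pow_le_pow_left₀ (norm_nonneg _) (by simpa using h i) 2
    _ = d * e ^ 2 := by simp
    _ ≤ (d * e) ^ 2 := by
        rw [mul_pow]
        refine mul_le_mul_of_nonneg_right ?_ (sq_nonneg e)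
        rcases Nat.eq_zero_or_pos d with h0 | h0
        · simp [h0]
        · exact le_self_pow₀ (by exact_mod_cast h0) two_ne_zero

/-- A set of parameters `(θ, h) + x u` with `θ` and `x` bounded and `h` in a set covered by the balls
around `T` contains a finite net. The net picks one member from each nonempty cell, a cell being
given by the grid cells of `θ` and `x` and a ball containing `h`; so its points belong to the set
itself although the centres of the balls need not. -/
lemma exists_finite_net {B : Set (Param d q)} {Θ : Set (EuclideanSpace ℝ (Fin d))}
    {H : Set (EuclideanSpace ℝ (Fin q) → ℝ)} {u : Param d q} {R L e : ℝ} (he : 0 < e)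
    (hB : ∀ β ∈ B, ∃ α ∈ Θ ×ˢ H, ∃ x : ℝ, |x| ≤ L ∧ β = α + x • u)
    (hΘ : ∀ θ ∈ Θ, ‖θ‖ ≤ R) {T : Finset (EuclideanSpace ℝ (Fin q) → ℝ)}
    (hT : ∀ h ∈ H, ∃ g ∈ T, weightedSupNorm w (h - g) ≤ ENNReal.ofReal e) (hR : 0 ≤ R)
    (hL : 0 ≤ L) :
    ∃ N : Finset (Param d q), (∀ β ∈ N, β ∈ B) ∧
      (N.card : ℝ) ≤ (2 * R / e + 2) ^ d * T.card * (2 * L / e + 2) ∧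
      ∀ β ∈ B, ∃ γ ∈ N,
        strongNorm w (β - γ) ≤ ENNReal.ofReal ((d + 2) * e) + ENNReal.ofReal e * strongNorm w u := by
  classical
  choose! a ha x hx hax using hB
  choose! g hgT hg using hT
  set grid : ℝ → Finset ℤ := fun R => Finset.Icc ⌊-R / e⌋ ⌊R / e⌋ with hgrid
  have hmem : ∀ {R y : ℝ}, |y| ≤ R → ⌊y / e⌋ ∈ grid R := by
    intro R y hy
    rw [abs_le] at hy
    rw [hgrid, Finset.mem_Icc]
    exact ⟨Int.floor_le_floor (by gcongr; exact hy.1), Int.floor_le_floor (by gcongr; exact hy.2)⟩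
  have hcard : ∀ R : ℝ, 0 ≤ R → ((grid R).card : ℝ) ≤ 2 * R / e + 2 := by
    intro R hR
    have h1 : (⌊R / e⌋ : ℝ) ≤ R / e := Int.floor_le _
    have h2 : -R / e < (⌊-R / e⌋ : ℝ) + 1 := Int.lt_floor_add_one _
    have h3 : (0 : ℤ) ≤ ⌊R / e⌋ + 1 - ⌊-R / e⌋ := by
      have : ⌊-R / e⌋ ≤ ⌊R / e⌋ := Int.floor_le_floor (by gcongr; linarith)
      omega
    have h4 : ((grid R).card : ℤ) = ⌊R / e⌋ + 1 - ⌊-R / e⌋ := by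
      rw [hgrid, Int.card_Icc, Int.toNat_of_nonneg h3]
    have h5 : ((grid R).card : ℝ) = (⌊R / e⌋ : ℝ) + 1 - ⌊-R / e⌋ := by exact_mod_cast h4
    rw [h5]
    have h6 : -R / e = -(R / e) := by ring
    rw [h6] at h2 ⊢
    have h7 : 2 * R / e = R / e + R / e := by ring
    linarith
  have hclose : ∀ {y z : ℝ}, ⌊y / e⌋ = ⌊z / e⌋ → |y - z| ≤ e := by
    intro y z hyz
    have h1 := Int.abs_sub_lt_one_of_floor_eq_floor hyz
    rw [← sub_div, abs_div, abs_of_pos he, div_lt_one he] at h1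
    exact h1.le
  have hcoord : ∀ β ∈ B, ∀ i, |(a β).1 i| ≤ R := fun β hβ i =>
    (by simpa using PiLp.norm_apply_le (a β).1 i : |(a β).1 i| ≤ ‖(a β).1‖).trans
      (hΘ _ (ha β hβ).1)
  set Cells : Finset ((Fin d → ℤ) × (EuclideanSpace ℝ (Fin q) → ℝ) × ℤ) :=
    (Fintype.piFinset fun _ : Fin d => grid R) ×ˢ T ×ˢ grid L with hCells
  set c : Param d q → (Fin d → ℤ) × (EuclideanSpace ℝ (Fin q) → ℝ) × ℤ := fun β =>
    (fun i => ⌊(a β).1 i / e⌋, g (a β).2, ⌊x β / e⌋) with hc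
  have hcmem : ∀ β ∈ B, c β ∈ Cells := by
    intro β hβ
    simp only [hCells, hc, Finset.mem_product, Fintype.mem_piFinset]
    exact ⟨fun i => hmem (hcoord β hβ i), hgT _ (ha β hβ).2, hmem (hx β hβ)⟩
  have hrep : ∀ z, (∃ β ∈ B, c β = z) → ∃ β ∈ B, c β = z := fun _ h => h
  choose! rep hrepB hrepc using hrep
  refine ⟨(Cells.filter fun z => ∃ β ∈ B, c β = z).image rep, ?_, ?_, ?_⟩
  · intro β hβ
    obtain ⟨z, hz, rfl⟩ := Finset.mem_image.1 hβ
    exact hrepB z (Finset.mem_filter.1 hz).2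
  · have h1 : ((Cells.filter fun z => ∃ β ∈ B, c β = z).image rep).card ≤ Cells.card :=
      Finset.card_image_le.trans (Finset.card_filter_le _ _)
    have h2 : (Cells.card : ℝ) = ((grid R).card : ℝ) ^ d * T.card * (grid L).card := by
      rw [hCells, Finset.card_product, Finset.card_product, Fintype.card_piFinset]
      simp [mul_assoc]
    calc _ ≤ (Cells.card : ℝ) := by exact_mod_cast h1
      _ ≤ _ := by
        rw [h2]
        have := hcard R hR
        have := hcard L hL
        gcongr
  · intro β hβ
    have hex : ∃ β' ∈ B, c β' = c β := ⟨β, hβ, rfl⟩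
    refine ⟨rep (c β), Finset.mem_image_of_mem _ (Finset.mem_filter.2 ⟨hcmem β hβ, hex⟩), ?_⟩
    set γ := rep (c β)
    have hγB : γ ∈ B := hrepB _ hex
    have hγc : c γ = c β := hrepc _ hex
    simp only [hc, Prod.mk.injEq] at hγc
    obtain ⟨h1, h2, h3⟩ := hγc
    have hdec : β - γ = (a β - a γ) + (x β - x γ) • u := by
      conv_lhs => rw [hax β hβ, hax γ hγB]
      module
    have hθ : ‖(a β).1 - (a γ).1‖ ≤ d * e :=
      norm_sub_le_of_coord he.le fun i => hclose (congrFun h1 i).symm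
    have hh : weightedSupNorm w ((a β).2 - (a γ).2) ≤ ENNReal.ofReal e + ENNReal.ofReal e := by
      have h4 : (a β).2 - (a γ).2 = ((a β).2 - g (a β).2) + -((a γ).2 - g (a γ).2) := by
        rw [h2]; abel
      rw [h4]
      refine (weightedSupNorm_add_le _ _).trans (add_le_add (hg _ (ha β hβ).2) ?_)
      rw [weightedSupNorm_neg]
      exact hg _ (ha γ hγB).2
    rw [hdec]
    refine (strongNorm_add_le _ _).trans (add_le_add ?_ ?_)
    · calc strongNorm w (a β - a γ) ≤ ENNReal.ofReal (d * e) + (ENNReal.ofReal e + ENNReal.ofReal e) := by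
            refine add_le_add ?_ hh
            rw [← ofReal_norm]
            exact ENNReal.ofReal_le_ofReal hθ
        _ = ENNReal.ofReal ((d + 2) * e) := by
            rw [← ENNReal.ofReal_add he.le he.le, ← ENNReal.ofReal_add (by positivity) (by positivity)]
            ring_nf
    · refine (strongNorm_smul_le _ _).trans (mul_le_mul_left ?_ _)
      rw [Real.enorm_eq_ofReal_abs]
      exact ENNReal.ofReal_le_ofReal (hclose h3.symm)

end Covering

/-! ### Envelopes of conditionally centred variables -/

section Envelope

variable {𝒴 𝒳 : Type*} [MeasurableSpace 𝒴] [MeasurableSpace 𝒳]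

lemma exists_measurable_majorant {S : Type*} [MeasurableSpace S] {P : Measure S} {f : S → ℝ≥0∞}
    {v : ℝ≥0∞} (h : outerExpectation P f < v) :
    ∃ g : S → ℝ≥0∞, Measurable g ∧ (∀ s, f s ≤ g s) ∧ ∫⁻ s, g s ∂P ≤ v := by
  unfold outerExpectation at h
  simp only [iInf_lt_iff] at h
  obtain ⟨g, hg, hfg, hlt⟩ := h
  exact ⟨g, hg, hfg, hlt.le⟩

/-- Centring a square-integrable variable at most doubles its square, up to adding twice its mean
square. -/
lemma enorm_sub_integral_sq_le {P : Measure 𝒴} [IsProbabilityMeasure P] {v : 𝒴 → ℝ}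
    (hv : Measurable v) (y : 𝒴) :
    ‖v y - ∫ z, v z ∂P‖ₑ ^ 2 ≤ 2 * ‖v y‖ₑ ^ 2 + 2 * ∫⁻ z, ‖v z‖ₑ ^ 2 ∂P := by
  have h1 : ‖∫ z, v z ∂P‖ₑ ^ 2 ≤ ∫⁻ z, ‖v z‖ₑ ^ 2 ∂P := by
    have h2 : ‖∫ z, v z ∂P‖ₑ ≤ (∫⁻ z, ‖v z‖ₑ ^ 2 ∂P) ^ (1 / 2 : ℝ) := by
      refine (enorm_integral_le_lintegral_enorm _).trans ?_
      have h3 := eLpNorm_le_eLpNorm_of_exponent_le (μ := P) one_le_two hv.aestronglyMeasurable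
      rw [eLpNorm_one_eq_lintegral_enorm,
        eLpNorm_eq_lintegral_rpow_enorm_toReal two_ne_zero ENNReal.ofNat_ne_top] at h3
      simpa using h3
    calc _ ≤ ((∫⁻ z, ‖v z‖ₑ ^ 2 ∂P) ^ (1 / 2 : ℝ)) ^ 2 := by gcongr
      _ = _ := by rw [← ENNReal.rpow_natCast, ← ENNReal.rpow_mul]; norm_num
  calc ‖v y - ∫ z, v z ∂P‖ₑ ^ 2 ≤ (‖v y‖ₑ + ‖∫ z, v z ∂P‖ₑ) ^ 2 := by
        gcongr; exact enorm_sub_le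
    _ ≤ 2 * (‖v y‖ₑ ^ 2 + ‖∫ z, v z ∂P‖ₑ ^ 2) := by
        by_cases ht : ‖∫ z, v z ∂P‖ₑ = ∞
        · simp [ht]
        · lift ‖∫ z, v z ∂P‖ₑ to ℝ≥0 using ht with b
          lift ‖v y‖ₑ to ℝ≥0 using enorm_ne_top with a
          exact_mod_cast add_sq_le (a := a) (b := b)
    _ ≤ _ := by rw [mul_add]; gcongr

lemma ae_integrable_of_integrable_fst {ν : Measure 𝒳} [IsProbabilityMeasure ν] {κ : Kernel 𝒳 𝒴}
    [IsMarkovKernel κ] {P : Measure (𝒴 × 𝒳)} (hP : P = (ν ⊗ₘ κ).map Prod.swap) {f : 𝒴 → ℝ}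
    (hf : Measurable f) (hfi : Integrable (fun z => f z.1) P) : ∀ᵐ x ∂ν, Integrable f (κ x) := by
  have hfm : Measurable fun z : 𝒴 × 𝒳 => f z.1 := hf.comp measurable_fst
  rw [hP, integrable_map_measure hfm.aestronglyMeasurable (by fun_prop)] at hfi
  exact ((Measure.integrable_compProd_iff hfi.aestronglyMeasurable).1 hfi).1

/-- From an envelope `G` of `ψ² (g - g₀)²` one obtains an envelope of `ψ²` times the square of the
conditionally centred difference. It is set to `∞` on a null set of `x` that does not depend on `g`,
so that the bound holds everywhere, for uncountably many `g` at once; elsewhere the integrability of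
`g` under `κ x` follows from that of `G` and `g₀`. -/
lemma exists_centred_envelope {ν : Measure 𝒳} [IsProbabilityMeasure ν] {κ : Kernel 𝒳 𝒴}
    [IsMarkovKernel κ] {P : Measure (𝒴 × 𝒳)} (hP : P = (ν ⊗ₘ κ).map Prod.swap)
    {G : 𝒴 × 𝒳 → ℝ≥0∞} (hG : Measurable G) {g₀ : 𝒴 → ℝ} (hg₀ : Measurable g₀)
    (hg₀i : Integrable (fun z => g₀ z.1) P) :
    ∃ G' : 𝒴 × 𝒳 → ℝ≥0∞, Measurable G' ∧ ∫⁻ z, G' z ∂P ≤ 4 * ∫⁻ z, G z ∂P ∧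
      ∀ (g : 𝒴 → ℝ) (ψ : ℝ) (x : 𝒳), Measurable g →
        (∀ y, ‖ψ‖ₑ ^ 2 * ‖g y - g₀ y‖ₑ ^ 2 ≤ G (y, x)) →
        ∀ y, ‖ψ * ((g y - ∫ z, g z ∂κ x) - (g₀ y - ∫ z, g₀ z ∂κ x))‖ₑ ^ 2 ≤ G' (y, x) := by
  classical
  set Gx : 𝒳 → ℝ≥0∞ := fun x => ∫⁻ y, G (y, x) ∂κ x with hGx
  have hGs : Measurable fun z : 𝒳 × 𝒴 => G z.swap := hG.comp measurable_swap
  have hGxm : Measurable Gx := hGs.lintegral_kernel_prod_right'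
  have hPint : ∀ F : 𝒴 × 𝒳 → ℝ≥0∞, Measurable F →
      ∫⁻ z, F z ∂P = ∫⁻ x, ∫⁻ y, F (y, x) ∂κ x ∂ν := by
    intro F hF
    rw [hP, lintegral_map hF measurable_swap]
    exact Measure.lintegral_compProd (hF.comp measurable_swap)
  have hae := ae_integrable_of_integrable_fst hP hg₀ hg₀i
  set N := toMeasurable ν {x | ¬ Integrable g₀ (κ x)} with hN
  have hN0 : ν N = 0 := by rw [hN, measure_toMeasurable]; exact hae
  have hNm : MeasurableSet N := measurableSet_toMeasurable _ _
  have hNi : ∀ x, x ∉ N → Integrable g₀ (κ x) := fun x hx => by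
    by_contra h
    exact hx (subset_toMeasurable ν {x | ¬ Integrable g₀ (κ x)} h)
  have hG'm : Measurable fun z : 𝒴 × 𝒳 => if z.2 ∈ N then ∞ else 2 * G z + 2 * Gx z.2 :=
    Measurable.ite (measurable_snd hNm) measurable_const
      ((hG.const_mul _).add ((hGxm.comp measurable_snd).const_mul _))
  refine ⟨fun z => if z.2 ∈ N then ∞ else 2 * G z + 2 * Gx z.2, hG'm, ?_, ?_⟩
  · rw [hPint _ hG'm, hPint G hG]
    have h1 : ∀ᵐ x ∂ν, x ∉ N := measure_eq_zero_iff_ae_notMem.1 hN0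
    calc _ = ∫⁻ x, 4 * Gx x ∂ν := by
          refine lintegral_congr_ae ?_
          filter_upwards [h1] with x hx
          simp only [hx, if_false]
          rw [lintegral_add_right _ measurable_const, lintegral_const_mul (f := fun y => G (y, x)) _
            (hG.comp measurable_prodMk_right)]
          simp only [lintegral_const, measure_univ, mul_one]
          rw [← add_mul]
          norm_num [hGx]
      _ ≤ _ := by rw [lintegral_const_mul _ hGxm]
  · intro g ψ x hg hle y
    by_cases hx : x ∈ N
    · simp [hx]
    by_cases hψ : ψ = 0
    · simp [hψ]
    by_cases hfin : Gx x = ∞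
    · simp [hfin]
    simp only [hx, if_false]
    set v : 𝒴 → ℝ := fun y => ψ * (g y - g₀ y) with hv
    have hvm : Measurable v := (hg.sub hg₀).const_mul _
    have hvG : ∀ y, ‖v y‖ₑ ^ 2 ≤ G (y, x) := fun y => by
      rw [hv, enorm_mul, mul_pow]; exact hle y
    have hvG' : ∫⁻ y, ‖v y‖ₑ ^ 2 ∂κ x ≤ Gx x := lintegral_mono hvG
    have hvi : Integrable v (κ x) := by
      refine MemLp.integrable (q := 2) one_le_two ⟨hvm.aestronglyMeasurable, ?_⟩
      rw [eLpNorm_lt_top_iff_lintegral_rpow_enorm_lt_top two_ne_zero ENNReal.ofNat_ne_top]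
      refine lt_of_le_of_lt ?_ (lt_top_iff_ne_top.2 hfin)
      simpa using hvG'
    have hgi : Integrable g (κ x) := by
      have h1 : g = fun y => ψ⁻¹ * v y + g₀ y := by
        funext y; simp only [hv]; field_simp; ring
      rw [h1]
      exact (hvi.const_mul _).add (hNi x hx)
    have h2 : ψ * ((g y - ∫ z, g z ∂κ x) - (g₀ y - ∫ z, g₀ z ∂κ x))
        = v y - ∫ z, v z ∂κ x := by
      simp only [hv]
      rw [integral_const_mul, integral_sub hgi (hNi x hx)]
      ring
    rw [h2]
    refine (enorm_sub_integral_sq_le hvm y).trans ?_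
    gcongr
    exact hvG y

/-- The conditionally centred differences are centred. -/
lemma integral_centred_eq_zero {ν : Measure 𝒳} [IsProbabilityMeasure ν] {κ : Kernel 𝒳 𝒴}
    [IsMarkovKernel κ] {P : Measure (𝒴 × 𝒳)} (hP : P = (ν ⊗ₘ κ).map Prod.swap)
    {g g₀ : 𝒴 → ℝ} (hgi : Integrable (fun z => g z.1) P)
    (hg₀i : Integrable (fun z => g₀ z.1) P) (hg : Measurable g) (hg₀ : Measurable g₀) {ψ : 𝒳 → ℝ}
    (hW : Integrable (fun z : 𝒴 × 𝒳 =>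
      ψ z.2 * ((g z.1 - ∫ y, g y ∂κ z.2) - (g₀ z.1 - ∫ y, g₀ y ∂κ z.2))) P) :
    ∫ z, ψ z.2 * ((g z.1 - ∫ y, g y ∂κ z.2) - (g₀ z.1 - ∫ y, g₀ y ∂κ z.2)) ∂P = 0 := by
  have hW' := hW
  rw [hP] at hW
  rw [integrable_map_measure hW.aestronglyMeasurable (by fun_prop)] at hW
  rw [hP] at hW'
  conv_lhs => rw [hP]
  rw [integral_map (by fun_prop) hW'.aestronglyMeasurable]
  refine (Measure.integral_compProd hW).trans ?_
  refine (integral_congr_ae ?_).trans (integral_zero _ _)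
  filter_upwards [ae_integrable_of_integrable_fst hP hg hgi,
    ae_integrable_of_integrable_fst hP hg₀ hg₀i] with x hx hx₀
  simp only [Function.comp, Prod.fst_swap, Prod.snd_swap]
  rw [integral_const_mul, integral_sub (f := fun y => g y - ∫ z, g z ∂κ x)
    (g := fun y => g₀ y - ∫ z, g₀ z ∂κ x) (hx.sub (integrable_const _))
    (hx₀.sub (integrable_const _)), integral_sub hx (integrable_const _),
    integral_sub hx₀ (integrable_const _)]
  simp

end Envelope

/-! ### The maximal inequality for residual increments -/

section LocalClass

variable {Ω 𝒴 𝒳 : Type*} [MeasurableSpace Ω] [MeasurableSpace 𝒴] [MeasurableSpace 𝒳] {d q : ℕ}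
  {w : ℝ}

lemma measurable_residual {κ : Kernel 𝒳 𝒴} [IsMarkovKernel κ] {ρ : 𝒴 → Param d q → ℝ}
    {α : Param d q} (h : Measurable fun y => ρ y α) :
    Measurable fun s : 𝒴 × 𝒳 => residual κ ρ s α := by
  unfold residual condMean
  refine (h.comp measurable_fst).sub ?_
  have h1 : StronglyMeasurable fun x => ∫ y, ρ y α ∂κ x :=
    StronglyMeasurable.integral_kernel_prod_right' (f := fun z : 𝒳 × 𝒴 => ρ z.2 α)
      (h.comp measurable_snd).stronglyMeasurable
  exact h1.measurable.comp measurable_snd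

/-- The maximal inequality for the weighted residual increments over a class `B` of parameters with a
finite net `N` of mesh `e`, after rescaling by `σ`. -/
lemma residual_maximal_inequality {μ : Measure Ω} [IsProbabilityMeasure μ] {S : ℤ → Ω → 𝒴 × 𝒳}
    (hS : ∀ t, Measurable (S t)) {P : Measure (𝒴 × 𝒳)} [IsProbabilityMeasure P]
    (hSP : ∀ t, μ.map (S t) = P) {ν : Measure 𝒳} [IsProbabilityMeasure ν] {κ : Kernel 𝒳 𝒴}
    [IsMarkovKernel κ] (hP : P = (ν ⊗ₘ κ).map Prod.swap) {ρ : 𝒴 → Param d q → ℝ} {α₀ : Param d q}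
    {B : Set (Param d q)} (hmeas : ∀ α ∈ insert α₀ B, Measurable fun y => ρ y α)
    (hint : ∀ α ∈ insert α₀ B, Integrable (fun s => ρ s.1 α) P)
    {k : ℕ} {Ψ : Fin k → 𝒳 → ℝ} (hΨ : ∀ j, Measurable (Ψ j))
    {G : 𝒴 × 𝒳 → ℝ≥0∞} (hG : Measurable G) {g σ s ε vD e : ℝ} (hσ : 0 < σ) (hs : 0 < s)
    (hε : 0 < ε) (hεs : ε ≤ s) (hgs : 4 * g * σ ^ 2 ≤ s) (hvD : vD * σ ^ 2 ≤ ε ^ 2)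
    (hGg : ∫⁻ z, G z ∂P ≤ ENNReal.ofReal g)
    (hΨG : ∀ j, ∀ α ∈ B, ∀ z, ‖Ψ j z.2‖ₑ ^ 2 * ‖ρ z.1 α - ρ z.1 α₀‖ₑ ^ 2 ≤ G z)
    (hD : ∀ j, ∀ γ ∈ B, ∃ D : 𝒴 × 𝒳 → ℝ≥0∞, Measurable D ∧ ∫⁻ z, D z ∂P ≤ ENNReal.ofReal vD ∧
      ∀ α ∈ B, strongNorm w (α - γ) < ENNReal.ofReal e →
        ∀ z, ‖Ψ j z.2‖ₑ ^ 2 * ‖residual κ ρ z α - residual κ ρ z γ‖ₑ ^ 2 ≤ D z)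
    {N : Finset (Param d q)} (hNB : ∀ γ ∈ N, γ ∈ B)
    (hN : ∀ α ∈ B, ∃ γ ∈ N, strongNorm w (α - γ) < ENNReal.ofReal e)
    {n b m : ℕ} (hb : 0 < b) (hn : n ≤ m * b) (τ : ℝ) {K : ℝ} (hK : 0 < K) :
    μ {ω | ∃ j, ∃ α ∈ B, 3 * (b * τ) + K < σ * |∑ t ∈ Finset.Icc 1 n, Ψ j (S (t : ℤ) ω).2 *
        (residual κ ρ (S (t : ℤ) ω) α - residual κ ρ (S (t : ℤ) ω) α₀)|}
      ≤ ENNReal.ofReal (n * s / K)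
        + b * ((2 * (k * N.card) : ℕ) * (2 * ENNReal.ofReal (Real.exp (2 * m * s - τ)))
          + m * betaMixing μ S b) := by
  classical
  have hα₀ : α₀ ∈ insert α₀ B := Set.mem_insert _ _
  have hB : ∀ {α}, α ∈ B → α ∈ insert α₀ B := fun h => Set.mem_insert_of_mem _ h
  obtain ⟨G', hG', hG'int, hG'le⟩ := exists_centred_envelope hP hG (hmeas α₀ hα₀) (hint α₀ hα₀)
  set W : Fin k → Param d q → 𝒴 × 𝒳 → ℝ := fun j α z =>
    Ψ j z.2 * (residual κ ρ z α - residual κ ρ z α₀) with hW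
  have hWG : ∀ j, ∀ α ∈ B, ∀ z, ‖W j α z‖ₑ ^ 2 ≤ G' z := fun j α hα z =>
    hG'le (fun y => ρ y α) (Ψ j z.2) z.2 (hmeas α (hB hα)) (fun y => hΨG j α hα (y, z.2)) z.1
  have hWm : ∀ j, ∀ α ∈ B, Measurable (W j α) := fun j α hα =>
    ((hΨ j).comp measurable_snd).mul
      ((measurable_residual (hmeas α (hB hα))).sub (measurable_residual (hmeas α₀ hα₀)))
  have hG'fin : ∫⁻ z, G' z ∂P ≤ ENNReal.ofReal (4 * g) := by
    refine hG'int.trans ?_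
    rw [ENNReal.ofReal_mul (by norm_num)]
    simp only [ENNReal.ofReal_ofNat]
    gcongr
  have hW0 : ∀ j, ∀ α ∈ B, ∫ z, W j α z ∂P = 0 := by
    intro j α hα
    refine integral_centred_eq_zero hP (hint α (hB hα)) (hint α₀ hα₀) (hmeas α (hB hα))
      (hmeas α₀ hα₀) ?_
    refine MemLp.integrable (q := 2) one_le_two ⟨(hWm j α hα).aestronglyMeasurable, ?_⟩
    rw [eLpNorm_lt_top_iff_lintegral_rpow_enorm_lt_top two_ne_zero ENNReal.ofNat_ne_top]
    refine lt_of_le_of_lt (lintegral_mono fun z => ?_) (hG'fin.trans_lt ENNReal.ofReal_lt_top)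
    simp only [ENNReal.toReal_ofNat, ENNReal.rpow_ofNat]
    exact hWG j α hα z
  choose! D hDm hDint hDle using hD
  have hσe : ∀ y : ℝ, ‖σ * y‖ₑ ^ 2 = ENNReal.ofReal (σ ^ 2) * ‖y‖ₑ ^ 2 := fun y => by
    rw [enorm_mul, mul_pow, enorm_sq_eq_ofReal σ]
  have key := mixing_maximal_inequality_of_envelope (μ := μ) hS hSP (J := Fin k × B)
    (I := Fin k × N) (W := fun i z => σ * W i.1 i.2 z) (V := fun i z => σ * W i.1 i.2 z)
    (G := fun z => ENNReal.ofReal (σ ^ 2) * G' z)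
    (D := fun i z => ENNReal.ofReal (σ ^ 2) * D i.1 i.2 z) (s := s) (ε := ε) hs hε hεs
    (hG'.const_mul _)
    (by
      rw [lintegral_const_mul _ hG']
      refine (mul_le_mul_right hG'fin _).trans ?_
      rw [← ENNReal.ofReal_mul (sq_nonneg σ), mul_comm]
      exact ENNReal.ofReal_le_ofReal hgs)
    (fun i z => by rw [hσe]; gcongr; exact hWG i.1 i.2 i.2.2 z)
    (fun i => (hWm i.1 i.2 (hNB _ i.2.2)).const_mul _)
    (fun i z => by rw [hσe]; gcongr; exact hWG i.1 i.2 (hNB _ i.2.2) z)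
    (fun i => by rw [integral_const_mul, hW0 i.1 i.2 (hNB _ i.2.2), mul_zero])
    (fun i => (hDm i.1 i.2 (hNB _ i.2.2)).const_mul _)
    (fun i => by
      rw [lintegral_const_mul _ (hDm i.1 i.2 (hNB _ i.2.2))]
      refine (mul_le_mul_right (hDint i.1 i.2 (hNB _ i.2.2)) _).trans ?_
      rw [← ENNReal.ofReal_mul (sq_nonneg σ), mul_comm]
      exact ENNReal.ofReal_le_ofReal hvD)
    (fun i => by
      obtain ⟨γ, hγ, hlt⟩ := hN i.2 i.2.2
      refine ⟨(i.1, ⟨γ, hγ⟩), fun z => ?_⟩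
      rw [← mul_sub, hσe]
      gcongr
      have h1 : W i.1 i.2 z - W i.1 γ z
          = Ψ i.1 z.2 * (residual κ ρ z i.2 - residual κ ρ z γ) := by
        simp only [hW]; ring
      simp only
      rw [h1, enorm_mul, mul_pow]
      exact hDle i.1 γ (hNB γ hγ) i.2 i.2.2 hlt z)
    hb hn τ hK
  have hcard : Fintype.card (Fin k × N) = k * N.card := by simp
  rw [hcard] at key
  refine le_trans (measure_mono ?_) key
  rintro ω ⟨j, α, hα, h⟩
  refine ⟨(j, ⟨α, hα⟩), ?_⟩
  simp only [hW]
  rw [← Finset.mul_sum, abs_mul, abs_of_pos hσ]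
  exact h

end LocalClass

/-! ### Rates -/

section Rates

/-- With residue classes modulo `b ≈ (2 / c) log n`, both the union bound over at most `n ^ (κ p)`
functions and the total decoupling error are `O(1 / n)`. -/
lemma mixing_error_le {n b I : ℕ} {p κ σ₀ c β₀ s : ℝ} (hn : 1 ≤ n) (hlog : 1 ≤ Real.log n)
    (hp : 1 ≤ p) (hκ : 0 ≤ κ) (hσ₀ : 0 < σ₀) (hc : 0 < c) (hβ₀ : 0 ≤ β₀)
    (hb : b = ⌈2 / c * Real.log n⌉₊) (hbn : b ≤ n) (hI : (I : ℝ) ≤ (n : ℝ) ^ (κ * p))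
    {β : ℝ≥0∞} (hβ : β ≤ ENNReal.ofReal (β₀ * Real.exp (-c * b)))
    (hs : n * s = σ₀ * (p * Real.log n ^ 2)) {M : ℝ} (hM : M = 4 + (κ + 2) * (2 / c + 1) / σ₀) :
    b * ((2 * I : ℕ) * (2 * ENNReal.ofReal
        (Real.exp (2 * (n / b + 1 : ℕ) * s - M * (n * s / b)))) + (n / b + 1 : ℕ) * β)
      ≤ ENNReal.ofReal ((4 + 2 * β₀) / n) := by
  set ℓ := Real.log n with hℓ
  have hn0 : (0 : ℝ) < n := by exact_mod_cast hn
  have hb0 : 0 < b := by rw [hb]; exact Nat.ceil_pos.2 (by positivity)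
  have hb0' : (0 : ℝ) < b := by exact_mod_cast hb0
  have hbl : 2 / c * ℓ ≤ b := by rw [hb]; exact Nat.le_ceil _
  have hbu : (b : ℝ) ≤ (2 / c + 1) * ℓ := by
    have := (Nat.ceil_lt_add_one (a := 2 / c * ℓ) (by positivity)).le
    rw [← hb] at this
    linarith
  have hmb : ((n / b + 1 : ℕ) : ℝ) * b ≤ 2 * n := by
    have h1 : n / b * b ≤ n := Nat.div_mul_le_self n b
    have h2 : (n / b + 1) * b ≤ 2 * n := by rw [add_mul]; omega
    exact_mod_cast h2
  set m := n / b + 1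
  have hs0 : 0 ≤ n * s := by rw [hs]; positivity
  have hs0' : 0 ≤ s := nonneg_of_mul_nonneg_right hs0 hn0
  -- the exponent beats the entropy `κ p log n`
  have hexp : 2 * (m : ℝ) * s - M * (n * s / b) ≤ -((κ + 2) * (p * ℓ)) := by
    have h1 : 2 * (m : ℝ) * s ≤ 4 * (n * s / b) := by
      rw [mul_div_assoc', le_div_iff₀ hb0']
      nlinarith
    have h2 : σ₀ * (p * ℓ) / (2 / c + 1) ≤ n * s / b := by
      rw [hs, div_le_div_iff₀ (by positivity) hb0']
      calc σ₀ * (p * ℓ) * b ≤ σ₀ * (p * ℓ) * ((2 / c + 1) * ℓ) := by gcongr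
        _ = _ := by ring
    have h3 : (κ + 2) * (p * ℓ) ≤ (κ + 2) * (2 / c + 1) / σ₀ * (n * s / b) := by
      calc (κ + 2) * (p * ℓ)
          = (κ + 2) * (2 / c + 1) / σ₀ * (σ₀ * (p * ℓ) / (2 / c + 1)) := by field_simp
        _ ≤ _ := by gcongr
    rw [hM, add_mul]
    linarith
  have hpow : ∀ y : ℝ, (n : ℝ) ^ y = Real.exp (y * ℓ) := fun y => by
    rw [Real.rpow_def_of_pos hn0, mul_comm]
  have hexp2 : Real.exp (-(2 * ℓ)) = 1 / (n * n) := by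
    rw [Real.exp_neg, two_mul, Real.exp_add, hℓ, Real.exp_log hn0, one_div]
  have hfirst : (I : ℝ) * Real.exp (2 * (m : ℝ) * s - M * (n * s / b)) ≤ 1 / (n * n) := by
    calc _ ≤ Real.exp (κ * p * ℓ) * Real.exp (-((κ + 2) * (p * ℓ))) := by
          rw [← hpow]; gcongr
      _ = Real.exp (-(2 * (p * ℓ))) := by rw [← Real.exp_add]; ring_nf
      _ ≤ Real.exp (-(2 * ℓ)) := by
          refine Real.exp_le_exp.2 ?_
          nlinarith
      _ = _ := hexp2
  have hβ' : β ≤ ENNReal.ofReal (β₀ / (n * n)) := by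
    refine hβ.trans (ENNReal.ofReal_le_ofReal ?_)
    rw [div_eq_mul_one_div, ← hexp2]
    gcongr
    have : c * (2 / c * ℓ) ≤ c * b := by gcongr
    have h2 : c * (2 / c * ℓ) = 2 * ℓ := by field_simp
    linarith
  set E := Real.exp (2 * (m : ℝ) * s - M * (n * s / b)) with hE
  have hE0 : 0 ≤ E := (Real.exp_pos _).le
  calc (b : ℝ≥0∞) * ((2 * I : ℕ) * (2 * ENNReal.ofReal E) + m * β)
      ≤ b * ((2 * I : ℕ) * (2 * ENNReal.ofReal E) + m * ENNReal.ofReal (β₀ / (n * n))) := by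
        gcongr
    _ = ENNReal.ofReal (b * ((2 * I : ℕ) * (2 * E) + m * (β₀ / (n * n)))) := by
        rw [ENNReal.ofReal_mul (by positivity), ENNReal.ofReal_add (by positivity) (by positivity),
          ENNReal.ofReal_mul (by positivity), ENNReal.ofReal_mul (by positivity),
          ENNReal.ofReal_mul (by positivity)]
        simp
    _ ≤ ENNReal.ofReal ((4 + 2 * β₀) / n) := by
        refine ENNReal.ofReal_le_ofReal ?_
        have hbn' : (b : ℝ) ≤ n := by exact_mod_cast hbn
        calc b * (((2 * I : ℕ) : ℝ) * (2 * E) + m * (β₀ / (n * n)))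
            = 4 * b * (I * E) + (m * b) * (β₀ / (n * n)) := by push_cast; ring
          _ ≤ 4 * n * (1 / (n * n)) + (2 * n) * (β₀ / (n * n)) := by gcongr
          _ = _ := by field_simp

/-- The cardinality of the net and of the basis, for a mesh `n ^ (-κ)`: at most a power `O(p)` of
`n`. -/
lemma net_card_mul_le {n d k : ℕ} {N T p κ R L Cc Ck : ℝ} (hn : 1 ≤ n) (hp : 1 ≤ p) (hκ : 0 ≤ κ)
    (hR : 0 ≤ R) (hL : 0 ≤ L) (hCc : 0 < Cc) (hT0 : 0 ≤ T) (hnR : 2 * R + 2 ≤ n)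
    (hnL : 2 * L + 2 ≤ n) (hnC : Cc ≤ n) (hnk : Ck ≤ n) (hk : (k : ℝ) ≤ Ck * n)
    (hT : T ≤ (Cc * n / (n : ℝ) ^ (-κ)) ^ p)
    (hN : N ≤ (2 * R / (n : ℝ) ^ (-κ) + 2) ^ d * T * (2 * L / (n : ℝ) ^ (-κ) + 2)) :
    k * N ≤ (n : ℝ) ^ (((κ + 1) * (d + 1) + (κ + 2) + 2) * p) := by
  have hn0 : (0 : ℝ) < n := by exact_mod_cast hn
  have hn1 : (1 : ℝ) ≤ n := by exact_mod_cast hn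
  have hinv : ∀ y : ℝ, y / (n : ℝ) ^ (-κ) = y * (n : ℝ) ^ κ := fun y => by
    rw [Real.rpow_neg hn0.le, div_inv_eq_mul]
  have hκ1 : 1 ≤ (n : ℝ) ^ κ := Real.one_le_rpow hn1 hκ
  have hgrid : ∀ y : ℝ, 2 * y + 2 ≤ n → 2 * y / (n : ℝ) ^ (-κ) + 2 ≤ (n : ℝ) ^ (κ + 1) := by
    intro y hy
    rw [hinv, Real.rpow_add_one hn0.ne']
    nlinarith
  have hT' : T ≤ (n : ℝ) ^ ((κ + 2) * p) := by
    refine hT.trans ?_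
    rw [Real.rpow_mul hn0.le]
    refine Real.rpow_le_rpow (by positivity) ?_ (by linarith)
    rw [hinv, Real.rpow_add hn0, Real.rpow_two]
    have : Cc * n * (n : ℝ) ^ κ ≤ n * n * (n : ℝ) ^ κ := by gcongr
    nlinarith
  have hk' : (k : ℝ) ≤ (n : ℝ) ^ (2 : ℝ) := by
    rw [Real.rpow_two]
    nlinarith
  have hN' : N ≤ ((n : ℝ) ^ (κ + 1)) ^ d * (n : ℝ) ^ ((κ + 2) * p) * (n : ℝ) ^ (κ + 1) := by
    refine hN.trans ?_
    have h1 := hgrid R hnR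
    have h2 := hgrid L hnL
    gcongr
  calc k * N ≤ (n : ℝ) ^ (2 : ℝ)
        * (((n : ℝ) ^ (κ + 1)) ^ d * (n : ℝ) ^ ((κ + 2) * p) * (n : ℝ) ^ (κ + 1)) := by
        refine (mul_le_mul_of_nonneg_left hN' (Nat.cast_nonneg k)).trans ?_
        gcongr
    _ = (n : ℝ) ^ (2 + ((κ + 1) * d + (κ + 2) * p + (κ + 1))) := by
        rw [← Real.rpow_natCast, ← Real.rpow_mul hn0.le, ← Real.rpow_add hn0,
          ← Real.rpow_add hn0, ← Real.rpow_add hn0]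
    _ ≤ _ := by
        refine Real.rpow_le_rpow_of_exponent_le hn1 ?_
        have : 0 ≤ ((κ + 1) * (d + 1) + 2) * (p - 1) := by
          have : 0 ≤ p - 1 := by linarith
          positivity
        nlinarith

/-- A finite net of mesh less than `n ^ (-κ₀)` whose logarithmic cardinality is `O(p log n)`. The grid
has mesh `n ^ (-κ₁)` with `κ₁ = κ₀ + |q₂| + 1`, which absorbs the norm `O(n ^ q₂)` of the direction `u`
and the constants. -/
lemma exists_net_of_entropy {n d q k : ℕ} {w p κ₀ κ₁ R L Cc Ck c₂ q₂ : ℝ} {B : Set (Param d q)}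
    {Θ : Set (EuclideanSpace ℝ (Fin d))} {H : Set (EuclideanSpace ℝ (Fin q) → ℝ)} {u : Param d q}
    (hn : 1 ≤ n) (hp : 1 ≤ p) (hκ₀ : 0 ≤ κ₀) (hκ₁ : κ₁ = κ₀ + |q₂| + 1) (hR : 0 ≤ R) (hL : 0 ≤ L)
    (hCc : 0 < Cc)
    (hB : ∀ β ∈ B, ∃ α ∈ Θ ×ˢ H, ∃ x : ℝ, |x| ≤ L ∧ β = α + x • u) (hΘ : ∀ θ ∈ Θ, ‖θ‖ ≤ R)
    (hcov : ((coveringNumber w ((n : ℝ) ^ (-κ₁)) H : ℕ∞) : ℝ≥0∞)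
      ≤ ENNReal.ofReal ((Cc * n / (n : ℝ) ^ (-κ₁)) ^ p))
    (hu : strongNorm w u ≤ ENNReal.ofReal (c₂ * (n : ℝ) ^ q₂)) (hnR : 2 * R + 2 ≤ n)
    (hnL : 2 * L + 2 ≤ n) (hnC : Cc ≤ n) (hnk : Ck ≤ n) (hnd : d + 2 + |c₂| < n)
    (hk : (k : ℝ) ≤ Ck * n) :
    ∃ N : Finset (Param d q), (∀ γ ∈ N, γ ∈ B) ∧
      (∀ β ∈ B, ∃ γ ∈ N, strongNorm w (β - γ) < ENNReal.ofReal ((n : ℝ) ^ (-κ₀))) ∧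
      ((k * N.card : ℕ) : ℝ) ≤ (n : ℝ) ^ (((κ₁ + 1) * (d + 1) + (κ₁ + 2) + 2) * p) := by
  have hn0 : (0 : ℝ) < n := by exact_mod_cast hn
  have hn1 : (1 : ℝ) ≤ n := by exact_mod_cast hn
  have hκ₁0 : 0 ≤ κ₁ := by rw [hκ₁]; positivity
  set e := (n : ℝ) ^ (-κ₀) with he
  set e₁ := (n : ℝ) ^ (-κ₁) with he₁
  have he0 : 0 < e := by positivity
  have he₁0 : 0 < e₁ := by positivity
  have hcovtop : coveringNumber w e₁ H ≠ ⊤ := by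
    intro h
    rw [h] at hcov
    simp at hcov
  obtain ⟨T, hT, hTcard⟩ := exists_finset_card_le_coveringNumber hcovtop
  have hTreal : (T.card : ℝ) ≤ (Cc * n / e₁) ^ p := by
    have h1 : (T.card : ℝ≥0∞) ≤ ENNReal.ofReal ((Cc * n / e₁) ^ p) := by
      refine le_trans ?_ hcov
      exact_mod_cast ENat.toENNReal_le.2 hTcard
    rw [← ENNReal.ofReal_natCast, ENNReal.ofReal_le_ofReal_iff (by positivity)] at h1
    exact h1
  obtain ⟨N, hNB, hNcard, hN⟩ := exists_finite_net he₁0 hB hΘ hT hR hL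
  have hmesh : ENNReal.ofReal ((d + 2) * e₁) + ENNReal.ofReal e₁ * strongNorm w u
      < ENNReal.ofReal e := by
    have h1 : strongNorm w u ≤ ENNReal.ofReal (|c₂| * (n : ℝ) ^ |q₂|) :=
      hu.trans (ENNReal.ofReal_le_ofReal (by
        gcongr
        exacts [le_abs_self _, le_abs_self _]))
    refine lt_of_le_of_lt (add_le_add le_rfl (mul_le_mul_right h1 _)) ?_
    rw [← ENNReal.ofReal_mul he₁0.le, ← ENNReal.ofReal_add (by positivity) (by positivity),
      ENNReal.ofReal_lt_ofReal_iff he0]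
    have hq : 1 ≤ (n : ℝ) ^ |q₂| := Real.one_le_rpow hn1 (abs_nonneg _)
    have hee : e₁ * (n : ℝ) ^ |q₂| * n = e := by
      rw [he₁, he, ← Real.rpow_add hn0, ← Real.rpow_add_one hn0.ne', hκ₁]
      ring_nf
    calc (d + 2) * e₁ + e₁ * (|c₂| * (n : ℝ) ^ |q₂|)
        ≤ (d + 2) * (e₁ * (n : ℝ) ^ |q₂|) + e₁ * (|c₂| * (n : ℝ) ^ |q₂|) := by
          gcongr
          exact le_mul_of_one_le_right he₁0.le hq
      _ = e₁ * (n : ℝ) ^ |q₂| * (d + 2 + |c₂|) := by ring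
      _ < e₁ * (n : ℝ) ^ |q₂| * n := by gcongr
      _ = e := hee
  refine ⟨N, hNB, fun β hβ => ?_, ?_⟩
  · obtain ⟨γ, hγ, hle⟩ := hN β hβ
    exact ⟨γ, hγ, hle.trans_lt hmesh⟩
  · push_cast
    exact net_card_mul_le hn hp hκ₁0 hR hL hCc (Nat.cast_nonneg _) hnR hnL hnC hnk hk hTreal hNcard

/-- A mesh `n ^ (-κ)` with `2 r κ = 2 |q₁| η + 2` makes the oscillations negligible, because the
rate `a` is bounded below by a power of `n`. -/
lemma oscillation_le {n : ℕ} {r η q₁ c₁ Ca Cb δ dn : ℝ} (hn : 1 ≤ n) (hr : 0 < r) (hη : 0 < η)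
    (hc₁ : 0 < c₁) (hCa : 0 < Ca) (hδ : c₁ * (n : ℝ) ^ (-q₁) ≤ δ)
    (hd : 1 / (n : ℝ) ≤ dn ^ 2) (hbig : 2 * Cb / (64 * Ca ^ 2 * (c₁ ^ η) ^ 2) ≤ n) :
    2 * Cb * ((n : ℝ) ^ (-((2 * |q₁| * η + 2) / (2 * r)))) ^ (2 * r) * (dn / δ ^ η) ^ 2
      ≤ (8 * Ca * dn ^ 2) ^ 2 := by
  have hn0 : (0 : ℝ) < n := by exact_mod_cast hn
  have hn1 : (1 : ℝ) ≤ n := by exact_mod_cast hn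
  have hδ0 : 0 < δ := lt_of_lt_of_le (by positivity) hδ
  have ha0 : 0 < δ ^ η := Real.rpow_pos_of_pos hδ0 η
  set y := (n : ℝ) ^ (-(|q₁| * η)) with hy
  have hy0 : 0 < y := by positivity
  have ha : c₁ ^ η * y ≤ δ ^ η := by
    calc c₁ ^ η * y = (c₁ * (n : ℝ) ^ (-|q₁|)) ^ η := by
          rw [Real.mul_rpow hc₁.le (by positivity), ← Real.rpow_mul hn0.le, hy]
          ring_nf
      _ ≤ δ ^ η := by
          refine Real.rpow_le_rpow (by positivity) (le_trans ?_ hδ) hη.le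
          gcongr
          exact le_abs_self _
  have he : ((n : ℝ) ^ (-((2 * |q₁| * η + 2) / (2 * r)))) ^ (2 * r) = y ^ 2 * (1 / n) * (1 / n) := by
    rw [← Real.rpow_mul hn0.le, hy, ← Real.rpow_natCast, ← Real.rpow_mul hn0.le, one_div,
      ← Real.rpow_neg_one, ← Real.rpow_add hn0, ← Real.rpow_add hn0]
    congr 1
    field_simp
    push_cast
    ring
  have ha2 : (c₁ ^ η) ^ 2 * y ^ 2 ≤ (δ ^ η) ^ 2 := by
    rw [← mul_pow]; gcongr
  rw [div_le_iff₀ (by positivity)] at hbig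
  rw [he, div_pow, mul_div_assoc', div_le_iff₀ (by positivity)]
  have h1 : 2 * Cb * (y ^ 2 * (1 / n) * (1 / n))
      ≤ 64 * Ca ^ 2 * ((c₁ ^ η) ^ 2 * y ^ 2) * (1 / n) := by
    calc 2 * Cb * (y ^ 2 * (1 / n) * (1 / n))
        ≤ n * (64 * Ca ^ 2 * (c₁ ^ η) ^ 2) * (y ^ 2 * (1 / n) * (1 / n)) := by gcongr
      _ = _ := by field_simp
  calc 2 * Cb * (y ^ 2 * (1 / n) * (1 / n)) * dn ^ 2
      ≤ 64 * Ca ^ 2 * ((c₁ ^ η) ^ 2 * y ^ 2) * (1 / n) * dn ^ 2 := by gcongr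
    _ ≤ 64 * Ca ^ 2 * (δ ^ η) ^ 2 * dn ^ 2 * dn ^ 2 := by gcongr
    _ = _ := by ring

end Rates

end SieveLearning

set_option maxHeartbeats 400000 in
theorem propositionA1
    {Ω 𝒴 𝒳 : Type*} [MeasurableSpace Ω] [MeasurableSpace 𝒴] [MeasurableSpace 𝒳]
    (μ : Measure Ω) [IsProbabilityMeasure μ]
    -- the data `S_t = (Y_{t+1}, X_t)`: strictly stationary, exponentially β-mixing
    (Y : ℤ → Ω → 𝒴) (X : ℤ → Ω → 𝒳) (S : ℤ → Ω → 𝒴 × 𝒳)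
    (hY : ∀ t, Measurable (Y t)) (hX : ∀ t, Measurable (X t))
    (hS : ∀ t ω, S t ω = (Y (t + 1) ω, X t ω))
    (h_stat : StrictlyStationary μ S)
    (β₀ c : ℝ) (hβ₀ : 0 < β₀) (hc : 0 < c)
    (h_mix : ∀ j : ℕ, betaMixing μ S j ≤ ENNReal.ofReal (β₀ * Real.exp (-c * j)))
    -- a regular conditional distribution of `Y_{t+1}` given `X_t`
    (κ : Kernel 𝒳 𝒴) [IsMarkovKernel κ]
    (hκ : (μ.map (X 0)) ⊗ₘ κ = μ.map (fun ω => (X 0 ω, Y 1 ω)))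
    -- the residual function, the true parameter, the weight, and the spaces `A n = Θ × H n`
    {d q : ℕ} (ρ : 𝒴 → Param d q → ℝ) (α₀ : Param d q) (w : ℝ) (hw : 0 < w)
    (Θ : Set (EuclideanSpace ℝ (Fin d))) (hΘ : IsCompact Θ)
    (H : ℕ → Set (EuclideanSpace ℝ (Fin q) → ℝ))
    (A : ℕ → Set (Param d q)) (hA : ∀ n, A n = Θ ×ˢ H n)
    -- dimension and complexity of the learning space
    (p : ℕ → ℝ) (hp : Tendsto p atTop atTop)
    (hpn : Tendsto (fun n : ℕ => p n * Real.log n / n) atTop (nhds 0))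
    (Cc : ℝ) (hCc : 0 < Cc)
    (h_cover : ∀ n : ℕ, 1 ≤ n → ∀ δ : ℝ, 0 < δ → δ ≤ 1 →
      ((coveringNumber w δ (H n) : ℕ∞) : ℝ≥0∞) ≤ ENNReal.ofReal ((Cc * n / δ) ^ p n))
    -- the linear sieve basis `Ψ n j`, `j < k n`
    (k : ℕ → ℕ) (Ck : ℝ) (hk : ∀ n : ℕ, 1 ≤ n → (k n : ℝ) ≤ Ck * n)
    (Ψ : (n : ℕ) → Fin (k n) → 𝒳 → ℝ) (hΨ : ∀ n j, Measurable (Ψ n j))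
    -- the best approximations `π_n α₀`, the tuning and approximation rates, `δ̄_n` and `δ_n`
    (π : ℕ → Param d q) (hπ : ∀ n : ℕ, 1 ≤ n → IsBestApprox w (A n) α₀ (π n))
    (lam φ : ℕ → ℝ≥0) (δbar δ : ℕ → ℝ≥0∞)
    (hδbar : ∀ n, δbar n = weakRate (μ.map (X 0)) κ ρ α₀ (π n) (lam n) (φ n) (k n) (p n) n)
    (hδ : ∀ n, δ n = strongRate w (μ.map (X 0)) κ ρ α₀ (A n) (π n) (lam n) (φ n) (k n) (p n) n)
    (c₁ q₁ : ℝ) (hc₁ : 0 < c₁)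
    (hδ_low : ∀ᶠ n : ℕ in atTop, ENNReal.ofReal (c₁ * (n : ℝ) ^ (-q₁)) ≤ δ n)
    -- the directions `u_n` and the local neighbourhoods `𝒞_n`
    (u : ℕ → Param d q) (C : ℝ) (hC : 0 < C) (𝒞 : ℕ → Set (Param d q))
    (h𝒞 : ∀ n, 𝒞 n = localNbhd w C (μ.map (X 0)) κ ρ α₀ (A n) (u n) (δ n) (δbar n) n)
    (c₂ q₂ : ℝ)
    (hu : ∀ᶠ n : ℕ in atTop, strongNorm w (u n) ≤ ENNReal.ofReal (c₂ * (n : ℝ) ^ q₂))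
    (hu_mem : ∀ n : ℕ, 1 ≤ n → ∀ α ∈ 𝒞 n, ∀ x : ℝ, |x| ≤ C / √n →
      α + x • u n ∈ perturbationClosure w (A n))
    -- `ρ(·, α)` is measurable and `ρ(Y_{t+1}, α)` integrable at the parameters involved
    (hρ_meas : ∀ n : ℕ, 1 ≤ n → ∀ α ∈ insert α₀ (perturbationClosure w (A n)),
      Measurable fun y => ρ y α)
    (hρ_int : ∀ n : ℕ, 1 ≤ n → ∀ α ∈ insert α₀ (perturbationClosure w (A n)),
      Integrable (fun ω => ρ (Y 1 ω) α) μ)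
    -- (a) moment condition
    (η Ca : ℝ) (hη : 0 < η) (hCa : 0 < Ca)
    (h_a : ∀ n : ℕ, 1 ≤ n →
      outerExpectation (μ.map (S 0)) (fun s =>
        (⨆ j : Fin (k n), ‖Ψ n j s.2‖ₑ ^ 2) *
          ⨆ α ∈ 𝒞 n, ⨆ (x : ℝ) (_ : |x| ≤ C / √n), ‖ρ s.1 (α + x • u n) - ρ s.1 α₀‖ₑ ^ 2)
        ≤ ENNReal.ofReal Ca * δ n ^ (2 * η))
    -- (b) Hölder-type continuity in mean square
    (r Cb : ℝ) (hr : 0 < r) (hCb : 0 < Cb)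
    (h_b : ∀ n : ℕ, 1 ≤ n → ∀ j : Fin (k n), ∀ α ∈ perturbationClosure w (A n),
      ∀ e : ℝ, 0 < e →
        outerExpectation (μ.map (S 0)) (fun s =>
          ‖Ψ n j s.2‖ₑ ^ 2 *
            ⨆ α₁ ∈ perturbationClosure w (A n),
              ⨆ (_ : strongNorm w (α₁ - α) < ENNReal.ofReal e),
                ‖residual κ ρ s α₁ - residual κ ρ s α‖ₑ ^ 2)
          ≤ ENNReal.ofReal (Cb * e ^ (2 * r))) :
    IsBigOInProb μ
      (fun n ω => ⨆ (j : Fin (k n)) (x : ℝ) (_ : |x| ≤ C / √n), ⨆ α ∈ 𝒞 n,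
        ‖(n : ℝ)⁻¹ * ∑ t ∈ Finset.Icc 1 n, Ψ n j (X (t : ℤ) ω) *
          (residual κ ρ (S (t : ℤ) ω) (α + x • u n) - residual κ ρ (S (t : ℤ) ω) α₀)‖ₑ)
      (fun n => ENNReal.ofReal (complexityRate (p n) n) * δ n ^ η) := by
  classical
  -- the observations and their common law
  have hSm : ∀ t, Measurable (S t) := fun t => by
    rw [funext (hS t)]
    exact (hY _).prodMk (hX t)
  have hSP : ∀ t, μ.map (S t) = μ.map (S 0) := map_eval_eq_of_strictlyStationary hSm h_stat
  have hS0 : S 0 = fun ω => (Y 1 ω, X 0 ω) := by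
    funext ω; rw [hS]; norm_num
  have hPprob : IsProbabilityMeasure (μ.map (S 0)) :=
    Measure.isProbabilityMeasure_map (hSm 0).aemeasurable
  have hνprob : IsProbabilityMeasure (μ.map (X 0)) :=
    Measure.isProbabilityMeasure_map (hX 0).aemeasurable
  have hP : μ.map (S 0) = ((μ.map (X 0)) ⊗ₘ κ).map Prod.swap := by
    rw [hκ, Measure.map_map measurable_swap ((hX 0).prodMk (hY 1)), hS0]
    rfl
  obtain ⟨R', hR'⟩ := hΘ.isBounded.exists_norm_le
  set R := max R' 0 with hR
  have hΘR : ∀ θ ∈ Θ, ‖θ‖ ≤ R := fun θ hθ => (hR' θ hθ).trans (le_max_left _ _)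
  have hR0 : 0 ≤ R := le_max_right _ _
  set L := 2 * C with hL
  -- the mesh sizes `n ^ (-κ₀)` (oscillations) and `n ^ (-κ₁)` (grid), and the entropy exponent `κ₂`
  set κ₀ := (2 * |q₁| * η + 2) / (2 * r) with hκ₀
  set κ₁ := κ₀ + |q₂| + 1 with hκ₁
  set κ₂ := (κ₁ + 1) * (d + 1) + (κ₁ + 2) + 2 with hκ₂
  have hκ₀0 : 0 ≤ κ₀ := by positivity
  have hκ₁0 : 0 ≤ κ₁ := by positivity
  have hκ₂0 : 0 ≤ κ₂ := by positivity
  set M := 4 + (κ₂ + 2) * (2 / c + 1) / (8 * Ca) with hM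
  have hM0 : 0 < M := by positivity
  intro e₀ he₀
  set M₁ := 16 * Ca / e₀ with hM₁
  have hM₁0 : 0 < M₁ := by positivity
  have hMf : 0 < 24 * M * Ca + M₁ := by positivity
  refine ⟨(24 * M * Ca + M₁).toNNReal, ?_⟩
  have hcast : Tendsto (fun n : ℕ => (n : ℝ)) atTop atTop := tendsto_natCast_atTop_atTop
  have hlog : Tendsto (fun n : ℕ => Real.log n) atTop atTop := Real.tendsto_log_atTop.comp hcast
  have hblock : ∀ᶠ n : ℕ in atTop, ⌈2 / c * Real.log n⌉₊ ≤ n := by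
    have h1 := hcast.eventually (Real.isLittleO_log_id_atTop.bound (half_pos hc))
    filter_upwards [h1, eventually_ge_atTop 1] with n h1 hn
    refine Nat.ceil_le.2 ?_
    have hn1 : (1 : ℝ) ≤ n := by exact_mod_cast hn
    rw [Real.norm_of_nonneg (Real.log_nonneg hn1), id, Real.norm_of_nonneg (by positivity)] at h1
    calc 2 / c * Real.log n ≤ 2 / c * (c / 2 * n) := by gcongr
      _ = n := by field_simp
  filter_upwards [eventually_ge_atTop 1, hlog.eventually_ge_atTop 1, hp.eventually_ge_atTop 1,
    hδ_low, hu, hblock, hcast.eventually_ge_atTop (2 * R + 2),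
    hcast.eventually_ge_atTop (2 * L + 2), hcast.eventually_ge_atTop Cc,
    hcast.eventually_ge_atTop Ck, hcast.eventually_gt_atTop (d + 2 + |c₂|),
    hcast.eventually_ge_atTop (2 * Cb / (64 * Ca ^ 2 * (c₁ ^ η) ^ 2)),
    hcast.eventually_ge_atTop ((4 + 2 * β₀) / (e₀ / 2))] with n hn hlogn hpn1 hδn hun hbn hnR hnL
      hnC hnk hnd hnbig hnerr
  have hn0 : (0 : ℝ) < n := by exact_mod_cast hn
  have hn1 : (1 : ℝ) ≤ n := by exact_mod_cast hn
  set dn := complexityRate (p n) n with hdn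
  have hdn2 : dn ^ 2 = p n * Real.log n ^ 2 / n := Real.sq_sqrt (by positivity)
  have hdn0 : 0 < dn := Real.sqrt_pos.2 (by positivity)
  -- if `δ_n = ∞` the claimed bound is infinite
  by_cases hδtop : δ n = ∞
  · have h1 : ((24 * M * Ca + M₁).toNNReal : ℝ≥0∞) * (ENNReal.ofReal dn * δ n ^ η) = ∞ := by
      rw [hδtop, ENNReal.top_rpow_of_pos hη, ENNReal.mul_top (by simpa using hdn0),
        ENNReal.mul_top (by simpa using hMf)]
    rw [h1]
    simp
  set D₀ := (δ n).toReal with hD₀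
  have hδD : δ n = ENNReal.ofReal D₀ := (ENNReal.ofReal_toReal hδtop).symm
  have hD₀low : c₁ * (n : ℝ) ^ (-q₁) ≤ D₀ := (ENNReal.ofReal_le_iff_le_toReal hδtop).1 hδn
  have hD₀0 : 0 < D₀ := lt_of_lt_of_le (by positivity) hD₀low
  set a := D₀ ^ η with ha
  have ha0 : 0 < a := Real.rpow_pos_of_pos hD₀0 η
  have hδη : δ n ^ η = ENNReal.ofReal a := by rw [hδD, ENNReal.ofReal_rpow_of_pos hD₀0]
  have hδ2η : δ n ^ (2 * η) = ENNReal.ofReal (a ^ 2) := by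
    rw [hδD, ENNReal.ofReal_rpow_of_pos hD₀0, ha, ← Real.rpow_natCast, ← Real.rpow_mul hD₀0.le]
    ring_nf
  set s := 8 * Ca * dn ^ 2 with hs
  have hs0 : 0 < s := by positivity
  have hσ0 : 0 < dn / a := by positivity
  set e := (n : ℝ) ^ (-κ₀) with he
  have he0 : 0 < e := by positivity
  have hxC : ∀ {x : ℝ}, |x| ≤ C / √n → |x| ≤ C := fun hx =>
    hx.trans (div_le_self hC.le (Real.one_le_sqrt.2 hn1))
  -- the class of all perturbed parameters
  set B : Set (Param d q) := {β | ∃ α ∈ 𝒞 n, ∃ x : ℝ, |x| ≤ C / √n ∧ β = α + x • u n} with hB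
  have hBcl : ∀ β ∈ B, β ∈ perturbationClosure w (A n) := by
    rintro β ⟨α, hα, x, hx, rfl⟩
    exact hu_mem n hn α hα x hx
  have hBsub : ∀ β ∈ insert α₀ B, β ∈ insert α₀ (perturbationClosure w (A n)) := fun β hβ =>
    Set.insert_subset_insert hBcl hβ
  have hBrep : ∀ β ∈ B, ∃ α ∈ Θ ×ˢ H n, ∃ x : ℝ, |x| ≤ L ∧ β = α + x • u n := by
    rintro β ⟨α, hα, x, hx, rfl⟩
    rw [h𝒞 n] at hα
    obtain ⟨α', hα', -, -, x', hx', rfl⟩ := hα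
    rw [hA n] at hα'
    refine ⟨α', hα', x' + x, (abs_add_le _ _).trans ?_, by module⟩
    linarith [hxC hx, hxC hx']
  obtain ⟨N, hNB, hN, hI⟩ := exists_net_of_entropy (k := k n) (w := w) hn hpn1 hκ₀0 hκ₁ hR0
    (by positivity : 0 ≤ L) hCc hBrep hΘR (h_cover n hn _ (by positivity)
      (Real.rpow_le_one_of_one_le_of_nonpos hn1 (by linarith))) hun hnR hnL hnC hnk hnd (hk n hn)
  -- the envelope
  obtain ⟨G, hGm, hGle, hGint⟩ := exists_measurable_majorant (v := ENNReal.ofReal (2 * Ca * a ^ 2))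
    (lt_of_le_of_lt (h_a n hn) (by
      rw [hδ2η, ← ENNReal.ofReal_mul hCa.le, ENNReal.ofReal_lt_ofReal_iff (by positivity)]
      have : 0 < Ca * a ^ 2 := by positivity
      linarith))
  have hΨG : ∀ j, ∀ β ∈ B, ∀ z : 𝒴 × 𝒳,
      ‖Ψ n j z.2‖ₑ ^ 2 * ‖ρ z.1 β - ρ z.1 α₀‖ₑ ^ 2 ≤ G z := by
    rintro j β ⟨α, hα, x, hx, rfl⟩ z
    refine le_trans (mul_le_mul' ?_ ?_) (hGle z)
    · exact le_iSup (fun j => ‖Ψ n j z.2‖ₑ ^ 2) j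
    · exact le_iSup₂_of_le α hα (le_iSup₂_of_le x hx le_rfl)
  have hD : ∀ j, ∀ γ ∈ B, ∃ D : 𝒴 × 𝒳 → ℝ≥0∞, Measurable D ∧
      ∫⁻ z, D z ∂(μ.map (S 0)) ≤ ENNReal.ofReal (2 * Cb * e ^ (2 * r)) ∧
      ∀ α ∈ B, strongNorm w (α - γ) < ENNReal.ofReal e →
        ∀ z, ‖Ψ n j z.2‖ₑ ^ 2 * ‖residual κ ρ z α - residual κ ρ z γ‖ₑ ^ 2 ≤ D z := by
    intro j γ hγ
    obtain ⟨D, hDm, hDle, hDint⟩ := exists_measurable_majorant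
      (v := ENNReal.ofReal (2 * Cb * e ^ (2 * r)))
      (lt_of_le_of_lt (h_b n hn j γ (hBcl γ hγ) e he0) (by
        rw [ENNReal.ofReal_lt_ofReal_iff (by positivity)]
        have : 0 < Cb * e ^ (2 * r) := by positivity
        linarith))
    refine ⟨D, hDm, hDint, fun α hα hlt z => le_trans ?_ (hDle z)⟩
    gcongr
    exact le_iSup₂_of_le α (hBcl α hα) (le_iSup_of_le hlt le_rfl)
  have hint : ∀ α ∈ insert α₀ B, Integrable (fun z : 𝒴 × 𝒳 => ρ z.1 α) (μ.map (S 0)) := by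
    intro α hα
    have hm : Measurable fun z : 𝒴 × 𝒳 => ρ z.1 α :=
      (hρ_meas n hn α (hBsub α hα)).comp measurable_fst
    rw [integrable_map_measure hm.aestronglyMeasurable (hSm 0).aemeasurable, hS0]
    exact hρ_int n hn α (hBsub α hα)
  -- residue classes modulo `b`, and the maximal inequality
  set b := ⌈2 / c * Real.log n⌉₊ with hb
  have hb0 : 0 < b := Nat.ceil_pos.2 (by positivity)
  have hnm : n ≤ (n / b + 1) * b := by
    have := Nat.div_add_mod' n b
    have := Nat.mod_lt n hb0
    rw [add_mul]; omega
  have hns : n * s = 8 * Ca * (p n * Real.log n ^ 2) := by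
    rw [hs, hdn2]; field_simp
  set τ := M * (n * s / b) with hτ
  set K := M₁ * (n * dn ^ 2) with hK
  have hK0 : 0 < K := by positivity
  have hdn_low : 1 / (n : ℝ) ≤ dn ^ 2 := by
    rw [hdn2]
    gcongr
    nlinarith
  have hmain := residual_maximal_inequality (μ := μ) (w := w) hSm hSP hP (α₀ := α₀) (B := B)
    (fun α hα => hρ_meas n hn α (hBsub α hα)) hint (hΨ n) hGm (g := 2 * Ca * a ^ 2) hσ0 hs0 hs0
    le_rfl (le_of_eq (by rw [hs]; field_simp; ring))
    (oscillation_le hn hr hη hc₁ hCa hD₀low hdn_low hnbig) hGint hΨG hD hNB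
    hN hb0 hnm τ hK0
  have herr := mixing_error_le hn hlogn hpn1 hκ₂0 (by positivity : 0 < 8 * Ca) hc hβ₀.le hb hbn hI
    (h_mix b) hns hM
  refine (measure_mono ?_).trans (hmain.trans ((add_le_add le_rfl herr).trans ?_))
  · intro ω hω
    simp only [Set.mem_ofPred_eq, lt_iSup_iff] at hω
    obtain ⟨j, x, hx, α, hα, hlt⟩ := hω
    refine ⟨j, α + x • u n, ⟨α, hα, x, hx, rfl⟩, ?_⟩
    have hXS : ∀ t : ℤ, (S t ω).2 = X t ω := fun t => by rw [hS]
    simp only [hXS]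
    set total := ∑ t ∈ Finset.Icc 1 n, Ψ n j (X (t : ℤ) ω) *
      (residual κ ρ (S (t : ℤ) ω) (α + x • u n) - residual κ ρ (S (t : ℤ) ω) α₀)
    have h1 : (24 * M * Ca + M₁) * (dn * a) < (n : ℝ)⁻¹ * |total| := by
      have h2 : ((24 * M * Ca + M₁).toNNReal : ℝ≥0∞) = ENNReal.ofReal (24 * M * Ca + M₁) := rfl
      rw [hδη, h2, ← ENNReal.ofReal_mul hdn0.le, ← ENNReal.ofReal_mul hMf.le,
        Real.enorm_eq_ofReal_abs, abs_mul, abs_of_pos (inv_pos.2 hn0)] at hlt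
      exact (ENNReal.ofReal_lt_ofReal_iff_of_nonneg (by positivity)).1 hlt
    have h3 : 3 * (b * τ) + K = n * (dn / a) * ((24 * M * Ca + M₁) * (dn * a)) := by
      have hb' : (b : ℝ) ≠ 0 := by exact_mod_cast hb0.ne'
      rw [hτ, hK, hs]
      field_simp
      ring
    rw [h3]
    calc n * (dn / a) * ((24 * M * Ca + M₁) * (dn * a))
        < n * (dn / a) * ((n : ℝ)⁻¹ * |total|) := by gcongr
      _ = dn / a * |total| := by field_simp
  · have h1 : n * s / K = e₀ / 2 := by
      rw [hs, hK, hM₁]; field_simp; norm_num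
    rw [h1, ← ENNReal.ofReal_add (by positivity) (by positivity)]
    refine ENNReal.ofReal_le_ofReal ?_
    have h2 : (4 + 2 * β₀) / n ≤ e₀ / 2 := by
      rw [div_le_iff₀ (by positivity)] at hnerr
      rw [div_le_iff₀ hn0]
      linarith
    linarith
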